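/- Let $n\ge 1$ and let $G$ be an abelian group with $|G|\le 2^{\aleph_n}$ (for instance, any countable abelian group). If $R(n,G)$ and the weak diamond $w\Diamond(S^n_{n+1})$ hold, then $R(n+1,G)$ holds. Here the notions are as follows. Quasi-order ${}^\omega\omega$ by eventual domination: $f\le^* g$ iff $f(i)\le g(i)$ for all but finitely many $i$; $(f\vee g)(i)=\max\{f(i),g(i)\}$. For $f\in{}^\omega\omega$ let $Q_f=\prod_{i\in\omega}G^{f(i)}\big/\bigoplus_{i\in\omega}G^{f(i)}$, and for $f\le^* g$ let $p^g_f:Q_g\to Q_f$ be the natural projection (restrict to the common domain and put $0$ at the missing coordinates, which lie in finitely many columns). For $X\subseteq{}^\omega\omega$ and $m\ge 0$ let $\mathbf Q^{(m)}\restriction X=\prod Q_{f_0}$, the product being over all $(m+1)$-tuples $f_0\le^*\dots\le^* f_m$ in $X$, and let $$(\delta^{m+1} x)_{f_0\dots f_{m+1}}=p^{f_1}_{f_0}(x_{f_1\dots f_{m+1}})+\sum_{i=1}^{m+1}(-1)^i x_{f_0\dots\widehat{f_i}\dots f_{m+1}} .$$ An $n$-coherent family on $X$ for $G$ ($n\ge1$)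 is an $x\in\mathbf Q^{(n-1)}\restriction X$, thus a family indexed by ordered $n$-tuples, with $\delta^{n}x=0$. It is trivial if $n\ge 2$ and $x=\delta^{n-1}y$ for some $y\in\mathbf Q^{(n-2)}\restriction X$, or if $n=1$ and there is $\psi:\omega\times\omega\to G$ such that for every $f\in X$ the element $x_f$ is the class of the restriction of $\psi$ to $\{(i,j): j<f(i)\}$. For an ordinal $\kappa$, a $\kappa$-chain is a set $C$ for which there is a bijection $\sigma:\kappa\to C$ such that $\alpha\le\beta$ implies $\sigma(\alpha)\le^*\sigma(\beta)$. The cofinality of $P$ is the least cardinality of a $\le^*$-cofinal subset of $P$. $R(n,G)$ says: for every $\vee$-closed $P\subseteq{}^\omega\omega$ with $\mathrm{cof}(P,\le^*)=\aleph_n$ and every $\omega_n$-chain $C\subseteq P$ that has no $\le^*$-upper bound in $P$, there is an $n$-coherent family on $P$ for $G$ whose restriction to $C$ is not trivial. $S^n_{n+1}=\{\alpha<\omega_{n+1}:\mathrm{cof}(\alpha)=\omega_n\}$, and $w\Diamond(S^n_{n+1})$ says: for every $F:2^{<\omega_{n+1}}\to 2$ there is $g:\omega_{n+1}\to2$ such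 that for every $b:\omega_{n+1}\to 2$ the set $\{\lambda\in S^n_{n+1}: g(\lambda)=F(b\restriction\lambda)\}$ is stationary in $\omega_{n+1}$. -/

import Mathlib

open scoped Cardinal Ordinal

noncomputable section

namespace DerivedLim

universe u v

/-! ### Inverse systems and the Roos complex -/

/-- An inverse system of abelian groups indexed by a quasi-order. -/
structure InvSystem (L : Type v) [Preorder L] where
  obj : L → Type u
  [grp : ∀ a, AddCommGroup (obj a)]
  /-- the bonding morphisms -/
  map : ∀ {a b : L}, a ≤ b → obj b →+ obj a
  map_refl : ∀ (a : L) (x : obj a), map (le_refl a) x = x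
  map_comp : ∀ {a b c : L} (hab : a ≤ b) (hbc : b ≤ c) (x : obj c),
    map hab (map hbc x) = map (hab.trans hbc) x

attribute [instance] InvSystem.grp

namespace InvSystem

variable {L : Type v} [Preorder L]

/-- The restriction of an inverse system to a set of indices. -/
def restrict (Q : InvSystem.{u} L) (S : Set L) : InvSystem.{u} S where
  obj a := Q.obj a
  map {a b} h := Q.map (a := (a : L)) (b := (b : L)) h
  map_refl a x := Q.map_refl (a : L) x
  map_comp {a b c} hab hbc x := Q.map_comp (a := (a : L)) (b := (b : L)) (c := (c : L)) hab hbc x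

/-- The `n`-th group of the Roos complex: the product of the groups `Q.obj (t 0)` over all ordered
`(n + 1)`-tuples `t 0 ≤ ... ≤ t n`. -/
abbrev Cochain (Q : InvSystem.{u} L) (n : ℕ) : Type (max u v) :=
  ∀ t : Fin (n + 1) →o L, Q.obj (t 0)

/-- The tuple `t` with its `i`-th entry removed. -/
def face {n : ℕ} (t : Fin (n + 2) →o L) (i : Fin (n + 2)) : Fin (n + 1) →o L :=
  t.comp (Fin.succAboveOrderEmb i).toOrderHom

/-- The coboundary map from degree `n` to degree `n + 1`. For `i ≠ 0` the `0`-th entry of `face t i`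
is `t 0`, so that the bonding morphism in the `i`-th summand is the identity; for `i = 0` it is the
bonding morphism from the group at `t 1` to the group at `t 0`. -/
def coboundary (Q : InvSystem.{u} L) {n : ℕ} (x : Q.Cochain n) : Q.Cochain (n + 1) :=
  fun t => ∑ i : Fin (n + 2),
    (-1 : ℤ) ^ (i : ℕ) • Q.map (t.monotone (Fin.zero_le (i.succAbove 0))) (x (face t i))

/-- The restriction of a cochain on `P` to a subset `C` of `P`. -/
def restrictCochain (Q : InvSystem.{u} L) {P C : Set L} (h : C ⊆ P) {n : ℕ}
    (x : (Q.restrict P).Cochain n) : (Q.restrict C).Cochain n :=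
  fun t => x ((⟨Set.inclusion h, fun _ _ hab => hab⟩ : C →o P).comp t)

end InvSystem

/-! ### Functions from `ω` to `ω` modulo finite, and the quotient system -/

/-- The set of functions from `ω` to `ω`, quasi-ordered by eventual domination. -/
def EvDom : Type := ℕ → ℕ

/-- `f ≤ g` means that `f i ≤ g i` for all but finitely many `i`. -/
instance : Preorder EvDom where
  le f g := {i : ℕ | ¬ f i ≤ g i}.Finite
  le_refl f := by simp
  le_trans f g h hfg hgh := by
    refine (hfg.union hgh).subset fun i hi => ?_
    by_contra hc
    simp only [Set.mem_union, Set.mem_ofPred_eq, not_or, not_not] at hc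
    exact hi (hc.1.trans hc.2)

/-- The pointwise maximum. -/
def vee (f g : EvDom) : EvDom := fun i => max (f i) (g i)

section Quotient

variable (G : Type u) [AddCommGroup G]

/-- The group `B_f`, the product over `i` of the groups `G ^ f(i)`. -/
abbrev BGroup (f : EvDom) : Type u := ∀ i : ℕ, Fin (f i) → G

/-- The subgroup `A_f` of `B_f`, the direct sum over `i` of the groups `G ^ f(i)`. -/
def ASubgroup (f : EvDom) : AddSubgroup (BGroup G f) where
  carrier := {b | {i : ℕ | b i ≠ 0}.Finite}
  zero_mem' := by simp
  add_mem' {a b} ha hb := by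
    refine (Set.Finite.union ha hb).subset fun i hi => ?_
    by_contra hc
    simp only [Set.mem_union, Set.mem_ofPred_eq, not_or, not_not] at hc
    exact hi (by simp [hc.1, hc.2])
  neg_mem' {a} ha := by simpa using ha

/-- Restriction of functions from the region under `g` to the region under `f`, with value `0` at
the points which are not under `g`. If `f i ≤ g i` for almost all `i`, these points lie in
finitely many columns. -/
def restrictB (f g : EvDom) : BGroup G g →+ BGroup G f where
  toFun b i j := if h : (j : ℕ) < g i then b i ⟨j, h⟩ else 0
  map_zero' := by
    funext i j
    simp
  map_add' a b := by
    funext i j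
    by_cases h : (j : ℕ) < g i <;> simp [h]

theorem restrictB_mem (f g : EvDom) :
    ASubgroup G g ≤ (ASubgroup G f).comap (restrictB G f g) := by
  intro b hb
  refine Set.Finite.subset hb fun i hi hc => hi ?_
  funext j
  simp [restrictB, hc]

/-- The group `Q_f = B_f / A_f`. -/
abbrev QGroup (f : EvDom) : Type u := BGroup G f ⧸ ASubgroup G f

/-- The natural projection from `Q_g` to `Q_f`, for `f` eventually dominated by `g`. -/
def projQ {f g : EvDom} (_h : f ≤ g) : QGroup G g →+ QGroup G f :=
  QuotientAddGroup.map (ASubgroup G g) (ASubgroup G f) (restrictB G f g) (restrictB_mem G f g)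

/-- The quotient system `B / A` with coefficients in `G`, indexed by all functions from `ω` to `ω`
with eventual domination. -/
def QSystem : InvSystem.{u} EvDom where
  obj f := QGroup G f
  map h := projQ G h
  map_refl f x := by
    induction x using QuotientAddGroup.induction_on with
    | H b =>
      change ((restrictB G f f b : BGroup G f) : QGroup G f) = _
      congr 1
      funext i j
      simp [restrictB]
  map_comp {f g h} hfg hgh x := by
    induction x using QuotientAddGroup.induction_on with
    | H b =>
      change ((restrictB G f g (restrictB G g h b) : BGroup G f) : QGroup G f) =
        ((restrictB G f h b : BGroup G f) : QGroup G f)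
      rw [QuotientAddGroup.eq]
      refine Set.Finite.subset hfg fun i hi hle => hi ?_
      funext j
      have hj : (j : ℕ) < g i := lt_of_lt_of_le j.2 hle
      simp [restrictB, hj]

/-- The class in `Q_f` of the restriction to the region under `f` of a function on `ω × ω`. -/
def gridClass (psi : ℕ → ℕ → G) (f : EvDom) : QGroup G f :=
  QuotientAddGroup.mk (fun i j => psi i j : BGroup G f)

/-- Triviality of a family in the quotient system restricted to `S`, in Roos degree `m` (that is, of
a family indexed by ordered `(m + 1)`-tuples). In positive degree it means being a coboundary. In
degree `0` it means that a single function on `ω × ω` induces all members of the family. -/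
def TrivialFamily (S : Set EvDom) :
    ∀ m : ℕ, ((QSystem G).restrict S).Cochain m → Prop
  | 0, x => ∃ psi : ℕ → ℕ → G, ∀ t : Fin 1 →o S, x t = gridClass G psi (t 0 : EvDom)
  | m + 1, x => ∃ y : ((QSystem G).restrict S).Cochain m,
      ((QSystem G).restrict S).coboundary y = x

end Quotient

/-! ### Chains, and the principle `R(n, G)` -/

/-- `C` is a `κ`-chain: it has a monotone enumeration by `κ` which is a bijection. -/
def IsChainOfLength {L : Type v} [Preorder L] (k : Ordinal.{0}) (C : Set L) : Prop :=
  ∃ s : Ordinal.{0} → L, Set.BijOn s (Set.Iio k) C ∧ MonotoneOn s (Set.Iio k)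

/-- `C` has no upper bound in `P`. -/
def UnboundedIn {L : Type v} [Preorder L] (C P : Set L) : Prop :=
  ¬ ∃ p ∈ P, ∀ c ∈ C, c ≤ p

/-- The principle `R(n, G)`, for `n ≥ 1`. An `n`-family is indexed by ordered `n`-tuples, so
that it is a cochain of Roos degree `n - 1` in the quotient system. -/
def R (n : ℕ) (G : Type u) [AddCommGroup G] : Prop :=
  ∀ (P C : Set EvDom) (hCP : C ⊆ P),
    (∀ f ∈ P, ∀ g ∈ P, vee f g ∈ P) →
    Order.cof P = ℵ_ (n : Ordinal.{0}) →
    IsChainOfLength (ω_ (n : Ordinal.{0})) C →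
    UnboundedIn C P →
    ∃ x : ((QSystem G).restrict P).Cochain (n - 1),
      ((QSystem G).restrict P).coboundary x = 0 ∧
      ¬ TrivialFamily G C (n - 1) ((QSystem G).restrictCochain hCP x)

/-! ### Weak diamond -/

/-- The weak diamond principle for a set `S` of ordinals below `k`: for every colouring `F` of the
binary sequences of length less than `k` with two colours, there is `g : k → 2` such that for all
`b : k → 2` the set of `a ∈ S` with `g a = F (b ↾ a)` is stationary in `k`. -/
def WeakDiamond (k : Ordinal.{0}) (S : Set (Set.Iio k)) : Prop :=
  ∀ F : (a : Set.Iio k) → (Set.Iio a → Bool) → Bool,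
    ∃ g : Set.Iio k → Bool, ∀ b : Set.Iio k → Bool,
      IsStationary {a : Set.Iio k | a ∈ S ∧ g a = F a (fun c => b c)}

/-- The set `S^n_{n+1}` of ordinals below `ω_{n+1}` of cofinality `ω_n`. -/
def cofSet (n : ℕ) : Set (Set.Iio (ω_ ((n + 1 : ℕ) : Ordinal.{0}))) :=
  {a | (a : Ordinal.{0}).cof = ℵ_ (n : Ordinal.{0})}

end DerivedLim

end

/-! Let n = k + 1 and enumerate C monotonically as s(a), a < ω_{n+1}. Take a cofinal p of the same
length with s(a) ≤ p(a), and let P_l consist of the members of P below a finite join of values p(a),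
a < l (`gen`). The P_l form a continuous increasing filtration of P by join-closed sets. For a club
of l the chain s[l] is unbounded in P_l; if also cof(l) = ω_n, then P_l has cofinality ℵ_n
(`cof_gen`), and R(n, G) gives a cocycle X_l on P_l of Roos degree k that is not trivial on s[l]
(`R.exists_cochain`).

The second ingredient is vanishing (`vanishes_gen`): on sets of cofinality at most ℵ_n, cocycles of
degree n are coboundaries. So each b : ω_{n+1} → 2 yields a cocycle Y_b of degree n on P, built
along the filtration: its part on P_a is some δw, and both δw and δ(w + X_a) extend that part to
P_{a+1}; b(a) selects one.

If z trivializes Y_b on C, then z minus the cochain selected at a is a cocycle on s[a+1], which has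
the largest element s(a); hence this difference is trivial on s[a]. Where X_a is not trivial on
s[a], the pair (b↾a, z↾s[a]) therefore determines b(a), since both answers together would trivialize
X_a. Because |G| ≤ 2^{ℵ_n}, the pair (b, z) can be coded by one binary sequence whose restriction to
a determines (b↾a, z↾s[a]) for a club of a (`exists_code_cochain`). The weak diamond guesses the
determined value; taking b opposite to the guess contradicts the existence of z. -/

noncomputable section

namespace DerivedLim

universe u v w

/-! ### Roos cochains on all of `L`, compared on subsets, and contraction to an upper bound. -/

namespace InvSystem

variable {L : Type v} [Preorder L] (Q : InvSystem.{u} L)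

/-- Two cochains agree on all tuples with entries in `S`. -/
def AgreeOn {k : ℕ} (S : Set L) (x y : Q.Cochain k) : Prop :=
  ∀ t : Fin (k + 1) →o L, (∀ i, t i ∈ S) → x t = y t

variable {Q}

theorem AgreeOn.mono {k : ℕ} {S T : Set L} {x y : Q.Cochain k} (h : Q.AgreeOn T x y)
    (hST : S ⊆ T) : Q.AgreeOn S x y :=
  fun t ht => h t fun i => hST (ht i)

theorem AgreeOn.symm {k : ℕ} {S : Set L} {x y : Q.Cochain k} (h : Q.AgreeOn S x y) :
    Q.AgreeOn S y x :=
  fun t ht => (h t ht).symm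

theorem AgreeOn.trans {k : ℕ} {S : Set L} {x y z : Q.Cochain k} (h : Q.AgreeOn S x y)
    (h' : Q.AgreeOn S y z) : Q.AgreeOn S x z :=
  fun t ht => (h t ht).trans (h' t ht)

theorem map_congr {k : ℕ} (x : Q.Cochain k) {a : L} {s s' : Fin (k + 1) →o L} (e : s = s')
    (h : a ≤ s 0) (h' : a ≤ s' 0) : Q.map h (x s) = Q.map h' (x s') := by
  subst e
  rfl

theorem zero_le_face {k : ℕ} (t : Fin (k + 2) →o L) (i : Fin (k + 2)) : t 0 ≤ face t i 0 :=
  t.monotone (Fin.zero_le _)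

theorem coboundary_apply {k : ℕ} (x : Q.Cochain k) (t : Fin (k + 2) →o L) :
    Q.coboundary x t =
      ∑ i : Fin (k + 2), (-1 : ℤ) ^ (i : ℕ) • Q.map (zero_le_face t i) (x (face t i)) :=
  rfl

theorem coboundary_add {k : ℕ} (x y : Q.Cochain k) :
    Q.coboundary (x + y) = Q.coboundary x + Q.coboundary y := by
  funext t
  simp [coboundary_apply, Finset.sum_add_distrib]

theorem coboundary_sub {k : ℕ} (x y : Q.Cochain k) :
    Q.coboundary (x - y) = Q.coboundary x - Q.coboundary y := by
  funext t
  simp [coboundary_apply, Finset.sum_sub_distrib, smul_sub]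

theorem AgreeOn.coboundary {k : ℕ} {S : Set L} {x y : Q.Cochain k} (h : Q.AgreeOn S x y) :
    Q.AgreeOn S (Q.coboundary x) (Q.coboundary y) := by
  intro t ht
  refine Finset.sum_congr rfl fun i _ => ?_
  rw [h (face t i) fun j => ht _]

theorem map_coboundary {k : ℕ} (x : Q.Cochain k) {a : L} (t : Fin (k + 2) →o L) (h : a ≤ t 0) :
    Q.map h (Q.coboundary x t) = ∑ i : Fin (k + 2), (-1 : ℤ) ^ (i : ℕ) •
      Q.map (h.trans (zero_le_face t i)) (x (face t i)) := by
  simp only [coboundary_apply, map_sum, map_zsmul]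
  refine Finset.sum_congr rfl fun i _ => ?_
  rw [Q.map_comp]

theorem coboundary_coboundary {k : ℕ} (x : Q.Cochain k) : Q.coboundary (Q.coboundary x) = 0 := by
  funext t
  have h0 : ∀ (i : Fin (k + 3)) (j : Fin (k + 2)), t 0 ≤ face (face t i) j 0 :=
    fun i j => t.monotone (Fin.zero_le _)
  have key : Q.coboundary (Q.coboundary x) t = ∑ p : Fin (k + 3) × Fin (k + 2),
      (-1 : ℤ) ^ ((p.1 : ℕ) + p.2) • Q.map (h0 p.1 p.2) (x (face (face t p.1) p.2)) := by
    rw [Fintype.sum_prod_type, coboundary_apply]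
    refine Finset.sum_congr rfl fun i _ => ?_
    rw [map_coboundary, Finset.smul_sum]
    refine Finset.sum_congr rfl fun j _ => ?_
    rw [smul_smul, pow_add]
  rw [key]
  -- Deleting the same two entries in the opposite order gives the same tuple with the opposite
  -- sign.
  refine Finset.sum_involution (fun p _ => (p.1.succAbove p.2, p.2.predAbove p.1)) ?_ ?_
    (fun _ _ => Finset.mem_univ _) ?_
  · rintro ⟨i, j⟩ -
    have hf : face (face t (i.succAbove j)) (j.predAbove i) = face (face t i) j := by
      ext m
      exact congrArg t (Fin.succAbove_succAbove_succAbove_predAbove i j m)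
    rw [map_congr x hf (h0 _ _) (h0 i j), ← add_smul]
    have := Fin.neg_one_pow_succAbove_add_predAbove (R := ℤ) i j
    simp only [this]
    simp
  · rintro ⟨i, j⟩ - - h
    exact Fin.succAbove_ne i j (congrArg Prod.fst h)
  · rintro ⟨i, j⟩ -
    simp [Fin.succAbove_succAbove_predAbove, Fin.predAbove_predAbove_succAbove]

/-- The tuple `t` followed by an upper bound `p`. -/
def snocTop {k : ℕ} (t : Fin (k + 1) →o L) (p : L) (h : ∀ i, t i ≤ p) : Fin (k + 2) →o L where
  toFun := Fin.snoc (α := fun _ => L) t p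
  monotone' := by
    intro i j hij
    induction j using Fin.lastCases with
    | last =>
      induction i using Fin.lastCases with
      | last => exact le_rfl
      | cast i => simpa using h i
    | cast j =>
      induction i using Fin.lastCases with
      | last => exact absurd hij (not_le.2 (Fin.castSucc_lt_last j))
      | cast i => simpa using t.monotone (by simpa using hij)

theorem snocTop_castSucc {k : ℕ} (t : Fin (k + 1) →o L) (p : L) (h : ∀ i, t i ≤ p)
    (i : Fin (k + 1)) : snocTop t p h i.castSucc = t i :=
  Fin.snoc_castSucc (α := fun _ => L) p t i

theorem snocTop_last {k : ℕ} (t : Fin (k + 1) →o L) (p : L) (h : ∀ i, t i ≤ p) :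
    snocTop t p h (Fin.last _) = p :=
  Fin.snoc_last (α := fun _ => L) p t

theorem le_snocTop_zero {k : ℕ} (t : Fin (k + 1) →o L) (p : L) (h : ∀ i, t i ≤ p) :
    t 0 ≤ snocTop t p h 0 :=
  (snocTop_castSucc t p h 0).ge

theorem face_snocTop_last {k : ℕ} (t : Fin (k + 1) →o L) (p : L) (h : ∀ i, t i ≤ p) :
    face (snocTop t p h) (Fin.last _) = t := by
  ext m
  change snocTop t p h ((Fin.last _).succAbove m) = t m
  rw [Fin.succAbove_last, snocTop_castSucc]

theorem face_le {k : ℕ} {t : Fin (k + 2) →o L} {p : L} (h : ∀ i, t i ≤ p) (i : Fin (k + 2))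
    (j : Fin (k + 1)) : face t i j ≤ p :=
  h _

theorem face_snocTop_castSucc {k : ℕ} (t : Fin (k + 2) →o L) (p : L) (h : ∀ i, t i ≤ p)
    (i : Fin (k + 2)) :
    face (snocTop t p h) i.castSucc = snocTop (face t i) p (face_le h i) := by
  ext m
  change snocTop t p h (i.castSucc.succAbove m) = _
  induction m using Fin.lastCases with
  | last =>
    rw [show i.castSucc.succAbove (Fin.last _) = Fin.last _ by simp, snocTop_last, snocTop_last]
  | cast m =>
    rw [Fin.castSucc_succAbove_castSucc, snocTop_castSucc, snocTop_castSucc]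
    rfl

open Classical in
/-- The contraction of a cochain along a bound `p`. -/
def contract {k : ℕ} (p : L) (x : Q.Cochain (k + 1)) : Q.Cochain k := fun s =>
  if h : ∀ i, s i ≤ p then Q.map (le_snocTop_zero s p h) (x (snocTop s p h)) else 0

theorem eq_map_of_coboundary_eq_zero {p : L} {x : Q.Cochain 0} {t : Fin 1 →o L}
    (h : ∀ i, t i ≤ p) (hx : Q.coboundary x (snocTop t p h) = 0) :
    x t = Q.map (h 0) (x ((OrderHom.const (Fin 1) p))) := by
  have hx' := (map_coboundary x _ (le_snocTop_zero t p h)).symm.trans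
    ((congrArg (Q.map (le_snocTop_zero t p h)) hx).trans (map_zero _))
  rw [Fin.sum_univ_two] at hx'
  have e0 : face (snocTop t p h) 0 = OrderHom.const (Fin 1) p := by
    ext m
    obtain rfl : m = 0 := Fin.eq_zero m
    exact snocTop_last t p h
  have e1 : face (snocTop t p h) 1 = t := face_snocTop_last t p h
  rw [map_congr x e0 _ (h 0), map_congr x e1 _ le_rfl, Q.map_refl] at hx'
  simp only [Fin.val_zero, pow_zero, one_smul, Fin.val_one, pow_one, neg_smul] at hx'
  exact (sub_eq_zero.1 (by rw [sub_eq_add_neg]; exact hx')).symm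

/-- The cocycle identity at `t` followed by `p` has `t` as its last face; solving for that term
expresses `x t` through faces ending in `p`, which is the usual cone argument. -/
theorem coboundary_contract {k : ℕ} {p : L} {x : Q.Cochain (k + 1)} {t : Fin (k + 2) →o L}
    (h : ∀ i, t i ≤ p) (hx : Q.coboundary x (snocTop t p h) = 0) :
    (-1 : ℤ) ^ (k + 1) • Q.coboundary (contract p x) t = x t := by
  have hx' := (map_coboundary x _ (le_snocTop_zero t p h)).symm.trans
    ((congrArg (Q.map (le_snocTop_zero t p h)) hx).trans (map_zero _))
  rw [Fin.sum_univ_castSucc,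
    map_congr x (face_snocTop_last t p h) _ le_rfl, Q.map_refl] at hx'
  have : Q.coboundary (contract p x) t = ∑ i : Fin (k + 2), (-1 : ℤ) ^ (i : ℕ) •
      Q.map ((le_snocTop_zero t p h).trans
        (zero_le_face (snocTop t p h) i.castSucc))
        (x (face (snocTop t p h) i.castSucc)) := by
    rw [coboundary_apply]
    refine Finset.sum_congr rfl fun i _ => ?_
    rw [contract, dif_pos (face_le h i), Q.map_comp]
    congr 1
    exact map_congr x (face_snocTop_castSucc t p h i).symm _ _
  rw [this]
  simp only [Fin.val_castSucc, Fin.val_last] at hx'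
  rw [eq_neg_of_add_eq_zero_left hx', smul_neg, smul_smul, ← neg_smul]
  have : -((-1 : ℤ) ^ (k + 1) * (-1) ^ (k + 1 + 1)) = 1 := by
    rw [pow_succ (-1 : ℤ) (k + 1), ← mul_assoc, ← mul_pow]
    simp
  rw [this, one_smul]

theorem coboundary_zsmul {k : ℕ} (m : ℤ) (x : Q.Cochain k) :
    Q.coboundary (m • x) = m • Q.coboundary x := by
  funext t
  simp only [coboundary_apply, Pi.smul_apply, map_zsmul, Finset.smul_sum]
  exact Finset.sum_congr rfl fun i _ => smul_comm _ _ _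

end InvSystem

namespace InvSystem

variable {L : Type v} [Preorder L] {Q : InvSystem.{u} L}

/-! ### Recursive construction of cochains along a rank function -/

/-- The largest rank of an entry of a tuple. -/
def tupleRank (r : L → Ordinal.{0}) {k : ℕ} (t : Fin (k + 1) →o L) : Ordinal.{0} :=
  Finset.univ.sup' Finset.univ_nonempty fun i => r (t i)

theorem tupleRank_lt_iff {r : L → Ordinal.{0}} {k : ℕ} {t : Fin (k + 1) →o L} {a : Ordinal.{0}} :
    tupleRank r t < a ↔ ∀ i, r (t i) < a := by
  simp [tupleRank]

theorem tupleRank_le_iff {r : L → Ordinal.{0}} {k : ℕ} {t : Fin (k + 1) →o L} {a : Ordinal.{0}} :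
    tupleRank r t ≤ a ↔ ∀ i, r (t i) ≤ a := by
  simp [tupleRank]

open Classical in
/-- The cochain on the tuples of rank less than `a` that is obtained by iterating the extension
operators `E b` for `b < a`. -/
def stage (r : L → Ordinal.{0}) {k : ℕ} (E : Ordinal.{0} → Q.Cochain k → Q.Cochain k)
    (a : Ordinal.{0}) : Q.Cochain k := fun t =>
  if _h : tupleRank r t < a then E (tupleRank r t) (stage r E (tupleRank r t)) t else 0
termination_by a
decreasing_by exact _h

/-- The union of all stages. -/
def limitStage (r : L → Ordinal.{0}) {k : ℕ} (E : Ordinal.{0} → Q.Cochain k → Q.Cochain k) :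
    Q.Cochain k := fun t => E (tupleRank r t) (stage r E (tupleRank r t)) t

/-- Used for causality: the stage at `a` built from a branch `b` depends only on `b` below `a`. -/
theorem stage_congr {r : L → Ordinal.{0}} {k : ℕ} {E E' : Ordinal.{0} → Q.Cochain k → Q.Cochain k}
    {a : Ordinal.{0}} (h : ∀ b < a, E b = E' b) : stage r E a = stage r E' a := by
  induction a using WellFoundedLT.induction with
  | ind a ih =>
    funext t
    rw [stage, stage]
    split_ifs with ht
    · rw [h _ ht, ih _ ht fun b hb => h b (hb.trans ht)]
    · rfl

theorem stage_agreeOn_limitStage (r : L → Ordinal.{0}) {k : ℕ}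
    (E : Ordinal.{0} → Q.Cochain k → Q.Cochain k) (a : Ordinal.{0}) :
    Q.AgreeOn {f | r f < a} (stage r E a) (limitStage r E) := by
  intro t ht
  rw [stage, dif_pos (tupleRank_lt_iff.2 ht), limitStage]

section Extension

variable {r : L → Ordinal.{0}} {k : ℕ} {E : Ordinal.{0} → Q.Cochain k → Q.Cochain k}
  {S : Set L} {y : Q.Cochain (k + 1)} {o : Ordinal.{0}}

theorem limitStage_agreeOn {a : Ordinal.{0}}
    (hE : Q.AgreeOn {f | f ∈ S ∧ r f < a} (E a (stage r E a)) (stage r E a)) :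
    Q.AgreeOn {f | f ∈ S ∧ r f ≤ a} (limitStage r E) (E a (stage r E a)) := by
  intro t ht
  have hle : tupleRank r t ≤ a := tupleRank_le_iff.2 fun i => (ht i).2
  obtain h | h := hle.lt_or_eq
  · have h' := tupleRank_lt_iff.1 h
    rw [hE t fun i => ⟨(ht i).1, h' i⟩, stage_agreeOn_limitStage r E a t h']
  · rw [limitStage, h]

/-- A tuple of rank `b` has all its faces in ranks at most `b`, where the limit agrees with `E b
(stage r E b)`. Thus a one-step extension property suffices, and limit steps need no argument. -/
theorem coboundary_limitStage_agreeOn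
    (hE : ∀ a < o, ∀ w : Q.Cochain k, Q.AgreeOn {f | f ∈ S ∧ r f < a} (Q.coboundary w) y →
      Q.AgreeOn {f | f ∈ S ∧ r f < a} (E a w) w ∧
        Q.AgreeOn {f | f ∈ S ∧ r f ≤ a} (Q.coboundary (E a w)) y)
    {a : Ordinal.{0}} (ha : a ≤ o) :
    Q.AgreeOn {f | f ∈ S ∧ r f < a} (Q.coboundary (limitStage r E)) y := by
  induction a using WellFoundedLT.induction with
  | ind a ih =>
    intro t ht
    have hlt : tupleRank r t < a := tupleRank_lt_iff.2 fun i => (ht i).2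
    have hst := stage_agreeOn_limitStage r E (tupleRank r t)
    obtain ⟨h1, h2⟩ := hE _ (hlt.trans_le ha) (stage r E (tupleRank r t))
      (((hst.mono fun f hf => hf.2).coboundary).trans (ih _ hlt (hlt.le.trans ha)))
    have hmem : ∀ i, t i ∈ {f | f ∈ S ∧ r f ≤ tupleRank r t} :=
      fun i => ⟨(ht i).1, tupleRank_le_iff.1 le_rfl i⟩
    rw [(limitStage_agreeOn h1).coboundary t hmem, h2 t hmem]

theorem coboundary_stage_agreeOn
    (hE : ∀ a < o, ∀ w : Q.Cochain k, Q.AgreeOn {f | f ∈ S ∧ r f < a} (Q.coboundary w) y →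
      Q.AgreeOn {f | f ∈ S ∧ r f < a} (E a w) w ∧
        Q.AgreeOn {f | f ∈ S ∧ r f ≤ a} (Q.coboundary (E a w)) y)
    {a : Ordinal.{0}} (ha : a ≤ o) :
    Q.AgreeOn {f | f ∈ S ∧ r f < a} (Q.coboundary (stage r E a)) y :=
  ((stage_agreeOn_limitStage r E a).mono fun _ hf => hf.2).coboundary.trans
    (coboundary_limitStage_agreeOn hE ha)

end Extension

/-! ### Restriction to a set of indices -/

variable (Q) in
/-- The restriction of a cochain to a set of indices. -/
def res (S : Set L) {k : ℕ} (x : Q.Cochain k) : (Q.restrict S).Cochain k :=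
  fun t => x ((⟨Subtype.val, fun _ _ h => h⟩ : S →o L).comp t)

theorem res_eq_iff {S : Set L} {k : ℕ} {x y : Q.Cochain k} :
    Q.res S x = Q.res S y ↔ Q.AgreeOn S x y :=
  ⟨fun h t ht => congrFun h ⟨fun i => ⟨t i, ht i⟩, fun _ _ hij => t.monotone hij⟩,
    fun h => funext fun t => h _ fun i => (t i).2⟩

/-- Extension by zero. It allows working with cochains on the whole index set and stating all
conditions as agreement on a subset. -/
theorem exists_res_eq (S : Set L) {k : ℕ} (x : (Q.restrict S).Cochain k) :
    ∃ x' : Q.Cochain k, Q.res S x' = x := by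
  classical
  refine ⟨fun t => if h : ∀ i, t i ∈ S then
    x ⟨fun i => ⟨t i, h i⟩, fun _ _ hij => t.monotone hij⟩ else 0, funext fun t => ?_⟩
  exact dif_pos fun i => (t i).2

theorem restrictCochain_res {P C : Set L} (h : C ⊆ P) {k : ℕ} (x : Q.Cochain k) :
    Q.restrictCochain h (Q.res P x) = Q.res C x :=
  rfl

end InvSystem

/-! ### Trivial families -/

section Trivial

variable (G : Type u) [AddCommGroup G]

open InvSystem

/-- A cochain on all of `EvDom` that is trivial. -/
def IsTrivial : ∀ {m : ℕ}, (QSystem G).Cochain m → Prop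
  | 0, x => ∃ psi : ℕ → ℕ → G, ∀ t, x t = gridClass G psi (t 0)
  | _ + 1, x => ∃ y, (QSystem G).coboundary y = x

/-- A cochain that agrees on `S` with a trivial one. -/
def TrivialOn (S : Set EvDom) {m : ℕ} (x : (QSystem G).Cochain m) : Prop :=
  ∃ x', IsTrivial G x' ∧ (QSystem G).AgreeOn S x x'

variable {G}

theorem map_gridClass (psi : ℕ → ℕ → G) {f g : EvDom} (h : f ≤ g) :
    (QSystem G).map h (gridClass G psi g) = gridClass G psi f := by
  change ((restrictB G f g _ : BGroup G f) : QGroup G f) = ((_ : BGroup G f) : QGroup G f)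
  rw [QuotientAddGroup.eq]
  refine Set.Finite.subset h fun i hi hle => hi ?_
  funext j
  have hj : (j : ℕ) < g i := lt_of_lt_of_le j.2 hle
  simp [restrictB, hj]

theorem exists_gridClass_eq (f : EvDom) (q : QGroup G f) : ∃ psi, gridClass G psi f = q := by
  induction q using QuotientAddGroup.induction_on with
  | H b =>
    refine ⟨fun i j => if h : j < f i then b i ⟨j, h⟩ else 0, ?_⟩
    refine congrArg _ (funext fun i => funext fun j => ?_)
    simp

theorem IsTrivial.coboundary_eq_zero : ∀ {m : ℕ} {x : (QSystem G).Cochain m}, IsTrivial G x →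
    (QSystem G).coboundary x = 0
  | 0, x, ⟨psi, h⟩ => by
    funext t
    have hq : ∀ q : (QSystem G).obj (t 0),
        (-1 : ℤ) ^ ((0 : Fin 2) : ℕ) • q + (-1 : ℤ) ^ ((1 : Fin 2) : ℕ) • q = 0 := fun q => by simp
    rw [coboundary_apply, Fin.sum_univ_two, h, h]
    erw [map_gridClass, map_gridClass]
    exact hq _
  | _ + 1, _, ⟨y, h⟩ => by
    rw [← h, coboundary_coboundary]

theorem IsTrivial.sub : ∀ {m : ℕ} {x y : (QSystem G).Cochain m}, IsTrivial G x → IsTrivial G y →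
    IsTrivial G (x - y)
  | 0, _, _, ⟨psi, h⟩, ⟨psi', h'⟩ => ⟨psi - psi', fun t => by
      rw [Pi.sub_apply, h, h']
      rfl⟩
  | _ + 1, _, _, ⟨y, h⟩, ⟨y', h'⟩ => ⟨y - y', by rw [coboundary_sub, h, h']⟩

theorem TrivialOn.sub {S : Set EvDom} {m : ℕ} {x y : (QSystem G).Cochain m}
    (hx : TrivialOn G S x) (hy : TrivialOn G S y) : TrivialOn G S (x - y) := by
  obtain ⟨x', hx, hx'⟩ := hx
  obtain ⟨y', hy, hy'⟩ := hy
  exact ⟨x' - y', hx.sub hy, fun t ht => congrArg₂ (· - ·) (hx' t ht) (hy' t ht)⟩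

theorem TrivialOn.mono {S T : Set EvDom} {m : ℕ} {x : (QSystem G).Cochain m}
    (hx : TrivialOn G T x) (h : S ⊆ T) : TrivialOn G S x :=
  let ⟨x', hx, hx'⟩ := hx
  ⟨x', hx, hx'.mono h⟩

theorem TrivialOn.congr {S : Set EvDom} {m : ℕ} {x y : (QSystem G).Cochain m}
    (hx : TrivialOn G S x) (h : (QSystem G).AgreeOn S y x) : TrivialOn G S y :=
  let ⟨x', hx, hx'⟩ := hx
  ⟨x', hx, h.trans hx'⟩

theorem trivialOn_zero_iff {S : Set EvDom} {x : (QSystem G).Cochain 0} :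
    TrivialOn G S x ↔ ∃ psi : ℕ → ℕ → G, ∀ t : Fin 1 →o EvDom, (∀ i, t i ∈ S) →
      x t = gridClass G psi (t 0) := by
  constructor
  · rintro ⟨x', ⟨psi, h⟩, hx⟩
    exact ⟨psi, fun t ht => (hx t ht).trans (h t)⟩
  · rintro ⟨psi, h⟩
    exact ⟨fun t => gridClass G psi (t 0), ⟨psi, fun t => rfl⟩, h⟩

theorem trivialOn_succ_iff {S : Set EvDom} {m : ℕ} {x : (QSystem G).Cochain (m + 1)} :
    TrivialOn G S x ↔ ∃ y, (QSystem G).AgreeOn S ((QSystem G).coboundary y) x := by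
  constructor
  · rintro ⟨x', ⟨y, rfl⟩, hx⟩
    exact ⟨y, hx.symm⟩
  · rintro ⟨y, h⟩
    exact ⟨_, ⟨y, rfl⟩, h.symm⟩

theorem trivialFamily_res_iff {S : Set EvDom} : ∀ {m : ℕ} {x : (QSystem G).Cochain m},
    TrivialFamily G S m ((QSystem G).res S x) ↔ TrivialOn G S x
  | 0, x => by
    rw [trivialOn_zero_iff]
    exact ⟨fun ⟨psi, h⟩ => ⟨psi, fun t ht =>
      h ⟨fun i => ⟨t i, ht i⟩, fun _ _ hij => t.monotone hij⟩⟩,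
      fun ⟨psi, h⟩ => ⟨psi, fun t => h _ fun i => (t i).2⟩⟩
  | m + 1, x => by
    rw [trivialOn_succ_iff]
    constructor
    · rintro ⟨y, hy⟩
      obtain ⟨y, rfl⟩ := exists_res_eq S y
      exact ⟨y, res_eq_iff.1 hy⟩
    · rintro ⟨y, hy⟩
      exact ⟨(QSystem G).res S y, res_eq_iff.2 hy⟩

/-- Cocycles on a set with a largest element are trivial. -/
theorem trivialOn_of_top {S : Set EvDom} {p : EvDom} (hp : p ∈ S) (h : ∀ f ∈ S, f ≤ p) :
    ∀ {m : ℕ} {x : (QSystem G).Cochain m},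
    (QSystem G).AgreeOn S ((QSystem G).coboundary x) 0 → TrivialOn G S x := by
  have hmem : ∀ {k : ℕ} (t : Fin (k + 1) →o EvDom) (ht : ∀ i, t i ∈ S) (i : Fin (k + 2)),
      snocTop t p (fun i => h _ (ht i)) i ∈ S := by
    intro k t ht i
    induction i using Fin.lastCases with
    | last => rwa [snocTop_last]
    | cast i => rw [snocTop_castSucc]; exact ht i
  intro m x hx
  match m with
  | 0 =>
    obtain ⟨psi, hpsi⟩ := exists_gridClass_eq (G := G) p (x (OrderHom.const (Fin 1) p))
    refine trivialOn_zero_iff.2 ⟨psi, fun t ht => ?_⟩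
    rw [eq_map_of_coboundary_eq_zero (fun i => h _ (ht i)) (hx _ (hmem t ht)), ← map_gridClass psi,
      hpsi]
  | m + 1 =>
    refine trivialOn_succ_iff.2 ⟨(-1 : ℤ) ^ (m + 1) • contract p x, fun t ht => ?_⟩
    rw [coboundary_zsmul]
    exact coboundary_contract (fun i => h _ (ht i)) (hx _ (hmem t ht))

end Trivial

/-! ### Enumerations by ordinals -/

theorem mk_Iio_omega (m : ℕ) :
    Cardinal.mk (Set.Iio (ω_ (m : Ordinal.{0}))) = Cardinal.lift.{1} (ℵ_ (m : Ordinal.{0})) := by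
  simp

theorem exists_image_Iio_omega {X : Type w} {A : Set X} (hA : A.Nonempty) {m : ℕ}
    (h : Cardinal.mk A ≤ ℵ_ (m : Ordinal.{w})) :
    ∃ p : Ordinal.{0} → X, p '' Set.Iio (ω_ (m : Ordinal.{0})) = A := by
  classical
  have : Nonempty A := hA.to_subtype
  have hle : Cardinal.lift.{1} (Cardinal.mk A) ≤
      Cardinal.lift.{w} (Cardinal.mk (Set.Iio (ω_ (m : Ordinal.{0})))) := by
    rw [mk_Iio_omega]
    have := Cardinal.lift_le.{1}.2 h
    simpa using this
  obtain ⟨e⟩ := Cardinal.lift_mk_le'.1 hle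
  obtain ⟨g, hg⟩ : ∃ g : Set.Iio (ω_ (m : Ordinal.{0})) → A, Function.Surjective g :=
    ⟨Function.invFun e, Function.invFun_surjective e.injective⟩
  refine ⟨fun a => if h : a < ω_ (m : Ordinal.{0}) then g ⟨a, h⟩ else g ⟨0, Ordinal.omega_pos _⟩, ?_⟩
  ext x
  constructor
  · rintro ⟨a, ha, rfl⟩
    have ha' : a < ω_ (m : Ordinal.{0}) := ha
    simp [ha']
  · intro hx
    obtain ⟨⟨a, ha⟩, hax⟩ := hg ⟨x, hx⟩
    have ha' : a < ω_ (m : Ordinal.{0}) := ha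
    exact ⟨a, ha, by simp [ha', hax]⟩

theorem mk_Iio_le {m : ℕ} {a : Ordinal.{0}} (ha : a < ω_ ((m + 1 : ℕ) : Ordinal.{0})) :
    Cardinal.mk (Set.Iio a) ≤ ℵ_ (m : Ordinal.{1}) := by
  have h : a.card < ℵ_ ((m + 1 : ℕ) : Ordinal.{0}) := by
    rw [← Cardinal.lt_ord, Cardinal.ord_aleph]
    exact ha
  rw [Nat.cast_add, Nat.cast_one, ← Cardinal.succ_aleph, Order.lt_succ_iff] at h
  rw [Cardinal.mk_Iio_ordinal]
  have := Cardinal.lift_le.{1}.2 h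
  simpa using this

theorem mk_image_Iio_le {X : Type w} (p : Ordinal.{0} → X) {m : ℕ} {a : Ordinal.{0}}
    (ha : a < ω_ ((m + 1 : ℕ) : Ordinal.{0})) :
    Cardinal.mk (p '' Set.Iio a) ≤ ℵ_ (m : Ordinal.{w}) := by
  have h1 := Cardinal.mk_image_le_lift (f := p) (s := Set.Iio a)
  have h2 := Cardinal.lift_le.{w}.2 (mk_Iio_le ha)
  have h3 := h1.trans h2
  rw [← Cardinal.lift_le.{1}]
  simpa using h3

/-! ### Sets generated by finite joins -/

/-- The pointwise maximum of a finite set of functions. -/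
def bigVee (F : Finset EvDom) : EvDom := fun i => F.sup fun f => f i

theorem le_of_pointwise {f g : EvDom} (h : ∀ i, f i ≤ g i) : f ≤ g := by
  change {i : ℕ | ¬ f i ≤ g i}.Finite
  simp [h]

theorem bigVee_mono {F F' : Finset EvDom} (h : F ⊆ F') : bigVee F ≤ bigVee F' :=
  le_of_pointwise fun _ => Finset.sup_mono h

theorem le_bigVee {F : Finset EvDom} {f : EvDom} (h : f ∈ F) : f ≤ bigVee F :=
  le_of_pointwise fun i => Finset.le_sup (f := fun f : EvDom => f i) h

theorem bigVee_mem {S : Set EvDom} (hS : ∀ f ∈ S, ∀ g ∈ S, vee f g ∈ S) {F : Finset EvDom}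
    (hF : F.Nonempty) (h : (F : Set EvDom) ⊆ S) : bigVee F ∈ S := by
  induction hF using Finset.Nonempty.cons_induction with
  | singleton a =>
    have : bigVee {a} = a := funext fun i => Finset.sup_singleton ..
    rw [this]
    exact h (by simp)
  | cons a s ha hs ih =>
    have : bigVee (Finset.cons a s ha) = vee a (bigVee s) := funext fun i => Finset.sup_cons ..
    rw [this]
    exact hS _ (h (by simp)) _ (ih fun f hf => h (by simp [Finset.mem_coe.1 hf]))

/-- The members of `S` that are dominated by the join of a finite nonempty subset of `A`. -/
def gen (S A : Set EvDom) : Set EvDom :=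
  {f | f ∈ S ∧ ∃ F : Finset EvDom, F.Nonempty ∧ (F : Set EvDom) ⊆ A ∧ f ≤ bigVee F}

theorem gen_subset (S A : Set EvDom) : gen S A ⊆ S := fun _ h => h.1

theorem gen_mono (S : Set EvDom) {A B : Set EvDom} (h : A ⊆ B) : gen S A ⊆ gen S B :=
  fun _ ⟨hf, F, hF, hFA, hle⟩ => ⟨hf, F, hF, hFA.trans h, hle⟩

theorem gen_empty (S : Set EvDom) : gen S ∅ = ∅ := by
  ext f
  simp only [gen, Set.mem_ofPred_eq, Set.mem_empty_iff_false, iff_false]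
  rintro ⟨-, F, ⟨a, ha⟩, hF, -⟩
  exact hF ha

theorem bigVee_mem_gen {S A : Set EvDom} (hS : ∀ f ∈ S, ∀ g ∈ S, vee f g ∈ S) (h : A ⊆ S)
    {F : Finset EvDom} (hF : F.Nonempty) (hFA : (F : Set EvDom) ⊆ A) : bigVee F ∈ gen S A :=
  ⟨bigVee_mem hS hF (hFA.trans h), F, hF, hFA, le_rfl⟩

theorem vee_le {f g h : EvDom} (hf : f ≤ h) (hg : g ≤ h) : vee f g ≤ h := by
  refine (Set.Finite.union hf hg).subset fun i hi => ?_
  by_contra hc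
  simp only [Set.mem_union, Set.mem_ofPred_eq, not_or, not_not] at hc
  exact hi (max_le hc.1 hc.2)

theorem left_le_vee (f g : EvDom) : f ≤ vee f g := le_of_pointwise fun _ => le_max_left _ _

theorem right_le_vee (f g : EvDom) : g ≤ vee f g := le_of_pointwise fun _ => le_max_right _ _

theorem gen_vee {S A : Set EvDom} (hS : ∀ f ∈ S, ∀ g ∈ S, vee f g ∈ S) :
    ∀ f ∈ gen S A, ∀ g ∈ gen S A, vee f g ∈ gen S A := by
  classical
  rintro f ⟨hf, F, hF, hFA, hle⟩ g ⟨hg, F', hF', hFA', hle'⟩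
  refine ⟨hS f hf g hg, F ∪ F', hF.mono Finset.subset_union_left, by simp [hFA, hFA'], vee_le ?_ ?_⟩
  · exact hle.trans (bigVee_mono Finset.subset_union_left)
  · exact hle'.trans (bigVee_mono Finset.subset_union_right)

/-- A finite set of indices has a largest element. This is the continuity of the filtration at
limits. -/
theorem mem_gen_image_Iio {S : Set EvDom} {p : Ordinal.{0} → EvDom} {a : Ordinal.{0}} {f : EvDom}
    (h : f ∈ gen S (p '' Set.Iio a)) : ∃ b < a, f ∈ gen S (p '' Set.Iic b) := by
  classical
  obtain ⟨hf, F, hF, hFA, hle⟩ := h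
  obtain ⟨F', hF', rfl⟩ := Finset.subset_set_image_iff.1 hFA
  have hne : F'.Nonempty := Finset.image_nonempty.1 hF
  refine ⟨F'.max' hne, hF' (F'.max'_mem hne), hf, _, hF, ?_, hle⟩
  rw [Finset.coe_image]
  exact Set.image_mono fun b hb => F'.le_max' b hb

/-- The least `b` such that `f` is dominated by a finite join of members of `p '' Set.Iic b`. -/
def genRank (p : Ordinal.{0} → EvDom) (f : EvDom) : Ordinal.{0} :=
  sInf {b | f ∈ gen Set.univ (p '' Set.Iic b)}

theorem genRank_le {S : Set EvDom} {p : Ordinal.{0} → EvDom} {b : Ordinal.{0}} {f : EvDom}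
    (h : f ∈ gen S (p '' Set.Iic b)) : genRank p f ≤ b :=
  csInf_le' ⟨trivial, h.2⟩

theorem mem_gen_genRank {S : Set EvDom} {p : Ordinal.{0} → EvDom} {a : Ordinal.{0}} {f : EvDom}
    (h : f ∈ gen S (p '' Set.Iio a)) : f ∈ gen S (p '' Set.Iic (genRank p f)) := by
  obtain ⟨b, -, hb⟩ := mem_gen_image_Iio h
  have : genRank p f ∈ {b | f ∈ gen Set.univ (p '' Set.Iic b)} := csInf_mem ⟨b, trivial, hb.2⟩
  exact ⟨h.1, this.2⟩

theorem gen_genRank_lt (S : Set EvDom) (p : Ordinal.{0} → EvDom) {a o : Ordinal.{0}} (h : a ≤ o) :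
    {f | f ∈ gen S (p '' Set.Iio o) ∧ genRank p f < a} = gen S (p '' Set.Iio a) := by
  ext f
  constructor
  · rintro ⟨hf, hlt⟩
    exact gen_mono S (Set.image_mono fun b hb => lt_of_le_of_lt hb hlt) (mem_gen_genRank hf)
  · intro hf
    obtain ⟨b, hb, hfb⟩ := mem_gen_image_Iio hf
    exact ⟨gen_mono S (Set.image_mono fun c hc => lt_of_lt_of_le hc h) hf,
      (genRank_le hfb).trans_lt hb⟩

theorem gen_genRank_le (S : Set EvDom) (p : Ordinal.{0} → EvDom) {a o : Ordinal.{0}} (h : a < o) :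
    {f | f ∈ gen S (p '' Set.Iio o) ∧ genRank p f ≤ a} = gen S (p '' Set.Iio (Order.succ a)) := by
  rw [← gen_genRank_lt S p (Order.succ_le_of_lt h)]
  simp

/-! ### Vanishing for small cofinality -/

theorem exists_diagonal {G : Type u} {f : ℕ → EvDom} {psi : ℕ → ℕ → ℕ → G}
    (h : ∀ m i, m ≤ i → ∀ᶠ c in Filter.atTop, ∀ j < f m c, psi m c j = psi i c j) :
    ∃ phi : ℕ → ℕ → G, ∀ m, ∀ᶠ c in Filter.atTop, ∀ j < f m c, psi m c j = phi c j := by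
  classical
  simp only [Filter.eventually_atTop] at h
  choose! N hN using h
  -- Column `c` is copied from `psi i` for the largest `i ≤ c` such that the agreements of `psi m`
  -- with `psi i`, for all `m ≤ i`, have set in by column `c`. This `i` tends to infinity with `c`.
  refine ⟨fun c => psi (Nat.findGreatest (fun i => ∀ m ≤ i, N m i ≤ c) c) c, fun m => ?_⟩
  have hev : ∀ᶠ c in Filter.atTop, m ≤ c ∧ ∀ m' ≤ m, N m' m ≤ c :=
    (Filter.eventually_ge_atTop m).and
      ((Filter.eventually_all_finite (Set.finite_Iic m)).2 fun m' _ => Filter.eventually_ge_atTop _)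
  filter_upwards [hev] with c ⟨hc, hc'⟩ j hj
  exact hN _ _ (Nat.le_findGreatest hc hc') _
    (Nat.findGreatest_spec (P := fun i => ∀ m ≤ i, N m i ≤ c) hc hc' _
      (Nat.le_findGreatest hc hc')) j hj

section Vanishing

variable {G : Type u} [AddCommGroup G]

open InvSystem

variable (G) in
/-- All cocycles of degree `k` on `S` are trivial on `S`. -/
def Vanishes (S : Set EvDom) (k : ℕ) : Prop :=
  ∀ x : (QSystem G).Cochain k, (QSystem G).AgreeOn S ((QSystem G).coboundary x) 0 → TrivialOn G S x

theorem trivialOn_empty {k : ℕ} (x : (QSystem G).Cochain k) : TrivialOn G ∅ x := by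
  match k with
  | 0 => exact trivialOn_zero_iff.2 ⟨0, fun t ht => (ht 0).elim⟩
  | k + 1 => exact trivialOn_succ_iff.2 ⟨0, fun t ht => (ht 0).elim⟩

theorem vanishes_gen_of_finite {S A : Set EvDom} (hS : ∀ f ∈ S, ∀ g ∈ S, vee f g ∈ S)
    (hA : A ⊆ S) (hfin : A.Finite) (k : ℕ) : Vanishes G (gen S A) k := by
  intro x hx
  obtain rfl | hne := A.eq_empty_or_nonempty
  · rw [gen_empty]
    exact trivialOn_empty x
  · have hF : hfin.toFinset.Nonempty := by simpa using hne
    refine trivialOn_of_top (p := bigVee hfin.toFinset)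
      (bigVee_mem_gen hS hA hF (by simp)) (fun f hf => ?_) hx
    obtain ⟨-, F, -, hFA, hle⟩ := hf
    exact hle.trans (bigVee_mono fun g hg => by simpa using hFA hg)

/-- If `v` trivializes `y` on `T`, then `w - v` is a cocycle on `S`, hence trivial there. A trivial
cochain is defined everywhere and is a cocycle everywhere, so adding it to `v` corrects `v` to match
`w` on `S` without changing the coboundary. -/
theorem exists_extension {S T : Set EvDom} (hST : S ⊆ T) {k : ℕ} (hS : Vanishes G S k)
    (hT : Vanishes G T (k + 1)) {y : (QSystem G).Cochain (k + 1)}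
    (hy : (QSystem G).AgreeOn T ((QSystem G).coboundary y) 0) {w : (QSystem G).Cochain k}
    (hw : (QSystem G).AgreeOn S ((QSystem G).coboundary w) y) :
    ∃ w', (QSystem G).AgreeOn S w' w ∧ (QSystem G).AgreeOn T ((QSystem G).coboundary w') y := by
  obtain ⟨v, hv⟩ := trivialOn_succ_iff.1 (hT y hy)
  obtain ⟨x', hx', hwx⟩ := hS (w - v) (by
    intro t ht
    rw [coboundary_sub, Pi.sub_apply, hw t ht, hv t fun i => hST (ht i), sub_self]
    rfl)
  refine ⟨v + x', fun t ht => ?_, ?_⟩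
  · rw [Pi.add_apply, ← hwx t ht]
    exact add_sub_cancel _ _
  · rw [coboundary_add, hx'.coboundary_eq_zero, add_zero]
    exact hv

/-- A trivialization is extended along the filtration. Degree `k + 1` supplies a trivialization at
the next stage and degree `k` corrects it to extend the previous one. -/
theorem vanishes_gen_image_Iio {S : Set EvDom} {p : Ordinal.{0} → EvDom} {o : Ordinal.{0}}
    (ho : ∀ a < o, Order.succ a < o) {k : ℕ}
    (h : ∀ a < o, Vanishes G (gen S (p '' Set.Iio a)) k)
    (h' : ∀ a < o, Vanishes G (gen S (p '' Set.Iio a)) (k + 1)) :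
    Vanishes G (gen S (p '' Set.Iio o)) (k + 1) := by
  classical
  intro y hy
  have hext : ∀ a : Ordinal.{0}, ∀ w : (QSystem G).Cochain k, ∃ w', a < o →
      (QSystem G).AgreeOn (gen S (p '' Set.Iio a)) ((QSystem G).coboundary w) y →
      (QSystem G).AgreeOn (gen S (p '' Set.Iio a)) w' w ∧
        (QSystem G).AgreeOn (gen S (p '' Set.Iio (Order.succ a))) ((QSystem G).coboundary w') y := by
    intro a w
    by_cases ha : a < o
    · by_cases hw : (QSystem G).AgreeOn (gen S (p '' Set.Iio a)) ((QSystem G).coboundary w) y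
      · obtain ⟨w', hw'⟩ := exists_extension
          (gen_mono S (Set.image_mono fun b hb => (lt_of_lt_of_le hb (Order.le_succ a) :)))
          (h a ha) (h' _ (ho a ha)) (hy.mono (gen_mono S (Set.image_mono fun b hb =>
            (lt_trans hb (ho a ha) :)))) hw
        exact ⟨w', fun _ _ => hw'⟩
      · exact ⟨w, fun _ h => (hw h).elim⟩
    · exact ⟨w, fun h => (ha h).elim⟩
  choose E hE using hext
  refine trivialOn_succ_iff.2 ⟨limitStage (genRank p) E, ?_⟩
  have := coboundary_limitStage_agreeOn (r := genRank p) (E := E) (S := gen S (p '' Set.Iio o))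
    (y := y) (o := o) (fun a ha w hw => ?_) le_rfl
  · rwa [gen_genRank_lt S p le_rfl] at this
  · rw [gen_genRank_lt S p ha.le] at hw ⊢
    rw [gen_genRank_le S p ha]
    exact hE a w ha hw

theorem gridClass_eq_iff {psi psi' : ℕ → ℕ → G} {f : EvDom} :
    gridClass G psi f = gridClass G psi' f ↔
      ∀ᶠ c in Filter.atTop, ∀ j < f c, psi c j = psi' c j := by
  rw [gridClass, gridClass, QuotientAddGroup.eq, ← Nat.cofinite_eq_atTop]
  change Set.Finite _ ↔ Set.Finite _
  refine iff_of_eq (congrArg _ (Set.ext fun c => not_congr ?_))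
  constructor
  · intro h j hj
    have := congrFun h ⟨j, hj⟩
    exact neg_add_eq_zero.1 this
  · intro h
    exact funext fun j => neg_add_eq_zero.2 (h j j.2)

/-- The finite joins of initial segments of an enumeration of `A` form a cofinal sequence, and the
functions representing the family along it are merged by `exists_diagonal`. -/
theorem vanishes_gen_of_countable {S A : Set EvDom} (hS : ∀ f ∈ S, ∀ g ∈ S, vee f g ∈ S)
    (hA : A ⊆ S) (hc : A.Countable) : Vanishes G (gen S A) 0 := by
  classical
  intro x hx
  obtain rfl | hne := A.eq_empty_or_nonempty
  · rw [gen_empty]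
    exact trivialOn_empty x
  obtain ⟨a, rfl⟩ := hc.exists_eq_range hne
  have hxle : ∀ {g g' : EvDom} (_ : g ∈ gen S (Set.range a)) (_ : g' ∈ gen S (Set.range a))
      (t : Fin 1 →o EvDom) (_ : t 0 = g) (hle : t 0 ≤ g'),
      x t = (QSystem G).map hle (x (OrderHom.const (Fin 1) g')) := by
    intro g g' hg hg' t htg hle
    have ht : ∀ i, t i ≤ g' := fun i => by rwa [Fin.eq_zero i]
    refine eq_map_of_coboundary_eq_zero ht (hx _ fun i => ?_)
    induction i using Fin.lastCases with
    | last => rwa [snocTop_last]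
    | cast i => rw [snocTop_castSucc, Fin.eq_zero i, htg]; exact hg
  let F : ℕ → Finset EvDom := fun m => (Finset.range (m + 1)).image a
  have hF : ∀ m, bigVee (F m) ∈ gen S (Set.range a) := fun m =>
    bigVee_mem_gen hS hA (by simp [F]) (by simp [F])
  have hFmono : ∀ m i, m ≤ i → bigVee (F m) ≤ bigVee (F i) := fun m i h =>
    bigVee_mono (Finset.image_subset_image (by simpa using h))
  choose psi hpsi using fun m => exists_gridClass_eq (G := G) (bigVee (F m))
    (x (OrderHom.const (Fin 1) (bigVee (F m))))
  obtain ⟨phi, hphi⟩ := exists_diagonal (f := fun m => bigVee (F m)) (psi := psi) fun m i h => by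
    rw [← gridClass_eq_iff, hpsi, hxle (hF m) (hF i) _ rfl (hFmono m i h),
      ← map_gridClass (psi i) (hFmono m i h), hpsi]
    rfl
  refine trivialOn_zero_iff.2 ⟨phi, fun t ht => ?_⟩
  obtain ⟨-, F', -, hF', hle⟩ := ht 0
  obtain ⟨m, hm⟩ : ∃ m, F' ⊆ F m := by
    rw [← Set.image_univ] at hF'
    obtain ⟨I, -, rfl⟩ := Finset.subset_set_image_iff.1 hF'
    refine ⟨I.sup id, Finset.image_subset_image fun i hi => ?_⟩
    simpa [Nat.lt_succ_iff] using Finset.le_sup (f := id) hi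
  have hle' : t 0 ≤ bigVee (F m) := hle.trans (bigVee_mono hm)
  rw [hxle (ht 0) (hF m) t rfl hle', ← hpsi, gridClass_eq_iff.2 (hphi m)]
  exact map_gridClass phi hle'

/-- Cocycles of degree at least `m` are trivial on sets of cofinality at most `ℵ_m`. -/
theorem vanishes_gen {S : Set EvDom} (hS : ∀ f ∈ S, ∀ g ∈ S, vee f g ∈ S) (m : ℕ) :
    ∀ k ≥ m, ∀ A ⊆ S, Cardinal.mk A ≤ ℵ_ (m : Ordinal.{0}) → Vanishes G (gen S A) k := by
  have hsucc : ∀ m : ℕ, ∀ a < ω_ (m : Ordinal.{0}), Order.succ a < ω_ (m : Ordinal.{0}) :=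
    fun m a ha => (Cardinal.isSuccLimit_omega _).succ_lt ha
  induction m with
  | zero =>
    intro k _ A hA hcard
    match k with
    | 0 => exact vanishes_gen_of_countable hS hA (by simpa using hcard)
    | k + 1 =>
      obtain rfl | hne := A.eq_empty_or_nonempty
      · rw [gen_empty]
        exact fun x _ => trivialOn_empty x
      obtain ⟨p, rfl⟩ := exists_image_Iio_omega hne hcard
      -- Below `ω` every stage is generated by a finite set, so it is empty or has a largest
      -- element, and all degrees vanish.
      have hfin : ∀ a < ω_ ((0 : ℕ) : Ordinal.{0}), ∀ k, Vanishes G (gen S (p '' Set.Iio a)) k := by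
        intro a ha k
        refine vanishes_gen_of_finite hS ((Set.image_mono fun b hb => (lt_trans hb ha :)).trans hA)
          (Set.Finite.image _ (?_ : (Set.Iio a).Finite)) k
        rw [← Set.finite_coe_iff, ← Cardinal.lt_aleph0_iff_finite, Cardinal.mk_Iio_ordinal,
          Cardinal.lift_lt_aleph0, Ordinal.card_lt_aleph0]
        simpa using ha
      exact vanishes_gen_image_Iio (hsucc 0) (fun a ha => hfin a ha k) fun a ha => hfin a ha _
  | succ m ih =>
    intro k hk A hA hcard
    -- The degree is now `k + 1 ≥ m + 1`, so the inductive hypothesis covers both degrees `k` and `k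
    -- + 1` at the earlier stages.
    obtain ⟨k, rfl⟩ : ∃ k', k = k' + 1 := ⟨k - 1, by omega⟩
    obtain rfl | hne := A.eq_empty_or_nonempty
    · rw [gen_empty]
      exact fun x _ => trivialOn_empty x
    obtain ⟨p, rfl⟩ := exists_image_Iio_omega hne hcard
    have hle : ∀ a < ω_ ((m + 1 : ℕ) : Ordinal.{0}), ∀ k ≥ m,
        Vanishes G (gen S (p '' Set.Iio a)) k := fun a ha k hk =>
      ih k hk _ ((Set.image_mono fun b hb => (lt_trans hb ha :)).trans hA) (mk_image_Iio_le p ha)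
    exact vanishes_gen_image_Iio (hsucc _) (fun a ha => hle a ha k (by omega))
      fun a ha => hle a ha _ (by omega)

end Vanishing

/-! ### Clubs and codings below `ω_{m+1}` -/

theorem cof_omega_natCast (m : ℕ) : (ω_ (m : Ordinal.{0})).cof = ℵ_ (m : Ordinal.{0}) := by
  cases m with
  | zero => simp
  | succ m =>
    rw [Nat.cast_add, Nat.cast_one]
    exact Cardinal.cof_omega_add_one _

theorem exists_bound_omega {ι : Type w} {m : ℕ} (hι : Cardinal.mk ι ≤ ℵ_ (m : Ordinal.{w}))
    (f : ι → Ordinal.{0}) (hf : ∀ i, f i < ω_ ((m + 1 : ℕ) : Ordinal.{0})) :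
    ∃ b < ω_ ((m + 1 : ℕ) : Ordinal.{0}), ∀ i, f i < b := by
  have hlim := Cardinal.isSuccLimit_omega ((m + 1 : ℕ) : Ordinal.{0})
  refine ⟨⨆ i, f i + 1, Ordinal.lift_iSup_add_one_lt_of_lt_cof ?_ hf, fun i => ?_⟩
  · rw [← Ordinal.lift_cof, cof_omega_natCast, Cardinal.lift_id']
    have h : ℵ_ (m : Ordinal.{w}) < ℵ_ ((m + 1 : ℕ) : Ordinal.{w}) :=
      Cardinal.aleph_lt_aleph.2 (by exact_mod_cast Nat.lt_succ_self m)
    simpa using hι.trans_lt h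
  · refine (Order.lt_add_one_iff.2 le_rfl).trans_le
      (le_ciSup (f := fun i => f i + 1) ⟨ω_ ((m + 1 : ℕ) : Ordinal.{0}), ?_⟩ i)
    rintro _ ⟨j, rfl⟩
    exact (hlim.add_one_lt (hf j)).le

/-- Unboundedness: iterate a function `h` with `h a` above all `f b`, `b < a`; the supremum of the
iterates stays below `ω_{m+1}`, whose cofinality is uncountable. -/
theorem isClub_closed {m : ℕ} {f : Ordinal.{0} → Ordinal.{0}}
    (hf : ∀ a < ω_ ((m + 1 : ℕ) : Ordinal.{0}), f a < ω_ ((m + 1 : ℕ) : Ordinal.{0})) :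
    IsClub {a : Set.Iio (ω_ ((m + 1 : ℕ) : Ordinal.{0})) | ∀ b < (a : Ordinal.{0}), f b < a} := by
  have hlim := Cardinal.isSuccLimit_omega ((m + 1 : ℕ) : Ordinal.{0})
  constructor
  · intro d hd _ _ a ha b hb
    obtain ⟨c, hc, hbc⟩ := (lt_isLUB_iff ha (b := ⟨b, hb.trans a.2⟩)).1 hb
    exact (hd hc b hbc).trans_le (ha.1 hc)
  · have hbd : ∀ a, ∃ c, a < ω_ ((m + 1 : ℕ) : Ordinal.{0}) →
        c < ω_ ((m + 1 : ℕ) : Ordinal.{0}) ∧ ∀ b < a, f b < c := by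
      intro a
      by_cases ha : a < ω_ ((m + 1 : ℕ) : Ordinal.{0})
      · obtain ⟨c, hc, h⟩ := exists_bound_omega (mk_Iio_le ha) (fun b => f b)
          fun b => hf b (lt_trans b.2 ha)
        exact ⟨c, fun _ => ⟨hc, fun b hb => h ⟨b, hb⟩⟩⟩
      · exact ⟨0, fun h => (ha h).elim⟩
    choose h hh using hbd
    rintro ⟨x, hx⟩
    have hcof : ℵ₀ < (ω_ ((m + 1 : ℕ) : Ordinal.{0})).cof := by
      rw [cof_omega_natCast, ← Cardinal.aleph_zero]
      exact Cardinal.aleph_lt_aleph.2 (by exact_mod_cast Nat.succ_pos m)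
    refine ⟨⟨Ordinal.nfp h x, Ordinal.nfp_lt_ord hcof (fun i hi => (hh i hi).1) hx⟩, ?_,
      Ordinal.le_nfp h x⟩
    intro b hb
    obtain ⟨i, hi⟩ := Ordinal.lt_nfp_iff.1 hb
    have hlt : ∀ i, h^[i] x < ω_ ((m + 1 : ℕ) : Ordinal.{0}) := by
      intro i
      induction i with
      | zero => exact hx
      | succ i ih =>
        rw [Function.iterate_succ_apply']
        exact (hh _ ih).1
    refine ((hh _ (hlt i)).2 b hi).trans_le ?_
    rw [← Function.iterate_succ_apply' h]
    exact Ordinal.iterate_le_nfp h x (i + 1)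

theorem omega_mul_succ_lt {m : ℕ} {a : Ordinal.{0}} (ha : a < ω_ ((m + 1 : ℕ) : Ordinal.{0})) :
    ω_ (m : Ordinal.{0}) * Order.succ a < ω_ ((m + 1 : ℕ) : Ordinal.{0}) := by
  have hlim := Cardinal.isSuccLimit_omega ((m + 1 : ℕ) : Ordinal.{0})
  rw [Cardinal.lt_omega_iff_card_lt, Ordinal.card_mul]
  refine Cardinal.mul_lt_of_lt (Cardinal.aleph0_le_aleph _) ?_
    (Cardinal.lt_omega_iff_card_lt.1 (hlim.succ_lt ha))
  rw [Ordinal.card_omega]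
  exact Cardinal.aleph_lt_aleph.2 (by exact_mod_cast Nat.lt_succ_self m)

/-- Objects described by bits, at most `ℵ_m` many of them at every stage, can be coded by binary
sequences of length `ω_{m+1}`, with initial segments corresponding to each other on a club. -/
theorem exists_code {J : Type v} [Nonempty J] {X : Type w} (bit : X → J → Bool)
    (A : Ordinal.{0} → Set J) {m : ℕ}
    (hA : ∀ a < ω_ ((m + 1 : ℕ) : Ordinal.{0}), Cardinal.mk (A a) ≤ ℵ_ (m : Ordinal.{v})) :
    ∃ (code : X → Ordinal.{0} → Bool) (f : Ordinal.{0} → Ordinal.{0}),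
      (∀ a < ω_ ((m + 1 : ℕ) : Ordinal.{0}), f a < ω_ ((m + 1 : ℕ) : Ordinal.{0})) ∧
      ∀ l < ω_ ((m + 1 : ℕ) : Ordinal.{0}), (∀ a < l, f a < l) → ∀ x x' : X,
        (∀ c < l, code x c = code x' c) → ∀ a < l, ∀ j ∈ A a, bit x j = bit x' j := by
  have hr : ∀ a, ∃ r : Ordinal.{0} → J, a < ω_ ((m + 1 : ℕ) : Ordinal.{0}) →
      ∀ j ∈ A a, ∃ i < ω_ (m : Ordinal.{0}), r i = j := by
    intro a
    by_cases ha : a < ω_ ((m + 1 : ℕ) : Ordinal.{0})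
    · obtain h | h := (A a).eq_empty_or_nonempty
      · exact ⟨fun _ => Classical.arbitrary J, fun _ j hj => by simp [h] at hj⟩
      · obtain ⟨p, hp⟩ := exists_image_Iio_omega h (hA a ha)
        exact ⟨p, fun _ j hj => by rwa [← hp] at hj⟩
    · exact ⟨fun _ => Classical.arbitrary J, fun h => (ha h).elim⟩
  choose r hr using hr
  -- Position `ω_m * a + i` records the `i`-th bit of block `a`. An `l` closed under `a ↦ ω_m * (a +
  -- 1)` contains every block with index below `l` in full.
  refine ⟨fun x c => bit x (r (c / ω_ (m : Ordinal.{0})) (c % ω_ (m : Ordinal.{0}))),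
    fun a => ω_ (m : Ordinal.{0}) * Order.succ a, fun a ha => omega_mul_succ_lt ha, ?_⟩
  intro l hl hcl x x' hxx a ha j hj
  obtain ⟨i, hi, rfl⟩ := hr a (ha.trans hl) j hj
  have hlt : ω_ (m : Ordinal.{0}) * a + i < l := by
    refine lt_trans ?_ (hcl a ha)
    change _ < ω_ (m : Ordinal.{0}) * Order.succ a
    rw [Ordinal.mul_succ]
    exact (add_lt_add_iff_left _).2 hi
  have := hxx _ hlt
  simpa [Ordinal.mul_add_mod_self, Ordinal.mul_add_div _ (Ordinal.omega_pos _).ne',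
    Ordinal.div_eq_zero_of_lt hi, Ordinal.mod_eq_of_lt hi] using this

theorem mk_finset_le {ι : Type w} {m : ℕ} (h : Cardinal.mk ι ≤ ℵ_ (m : Ordinal.{w})) :
    Cardinal.mk (Finset ι) ≤ ℵ_ (m : Ordinal.{w}) := by
  classical
  have hs : Function.Surjective (List.toFinset : List ι → Finset ι) := List.toFinset_surjective
  exact (Cardinal.mk_le_of_surjective hs).trans
    ((Cardinal.mk_list_le_max ι).trans (max_le (Cardinal.aleph0_le_aleph _) h))

theorem mk_prod_le {X : Type v} {Y : Type w} {m : ℕ} (hX : Cardinal.mk X ≤ ℵ_ (m : Ordinal.{v}))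
    (hY : Cardinal.mk Y ≤ ℵ_ (m : Ordinal.{w})) :
    Cardinal.mk (X × Y) ≤ ℵ_ (m : Ordinal.{max v w}) := by
  rw [Cardinal.mk_prod]
  refine (mul_le_mul' (Cardinal.lift_le.2 hX) (Cardinal.lift_le.2 hY)).trans ?_
  simp

theorem mk_sum_le {X : Type v} {Y : Type w} {m : ℕ} (hX : Cardinal.mk X ≤ ℵ_ (m : Ordinal.{v}))
    (hY : Cardinal.mk Y ≤ ℵ_ (m : Ordinal.{w})) :
    Cardinal.mk (X ⊕ Y) ≤ ℵ_ (m : Ordinal.{max v w}) := by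
  rw [Cardinal.mk_sum]
  refine (add_le_add (Cardinal.lift_le.2 hX) (Cardinal.lift_le.2 hY)).trans ?_
  simp

theorem mk_fin_arrow_le {X : Type v} {k m : ℕ} (hX : Cardinal.mk X ≤ ℵ_ (m : Ordinal.{v})) :
    Cardinal.mk (Fin k → X) ≤ ℵ_ (m : Ordinal.{v}) := by
  rw [Cardinal.mk_arrow]
  simp only [Cardinal.lift_uzero, Cardinal.mk_fin, Cardinal.lift_natCast]
  exact (Cardinal.power_le_power_right hX).trans (Cardinal.power_nat_le (Cardinal.aleph0_le_aleph _))

theorem mk_nat_le (m : ℕ) : Cardinal.mk ℕ ≤ ℵ_ (m : Ordinal.{0}) := by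
  simp

theorem exists_bits {X : Type u} {m : ℕ} (h : Cardinal.mk X ≤ 2 ^ ℵ_ (m : Ordinal.{u})) :
    ∃ bit : X → Ordinal.{0} → Bool, ∀ x x',
      (∀ c < ω_ (m : Ordinal.{0}), bit x c = bit x' c) → x = x' := by
  classical
  have hle : Cardinal.lift.{1} (Cardinal.mk X) ≤
      Cardinal.lift.{u} (Cardinal.mk (Set.Iio (ω_ (m : Ordinal.{0})) → Bool)) := by
    rw [Cardinal.mk_arrow]
    have := Cardinal.lift_le.{1}.2 h
    simpa using this
  obtain ⟨e⟩ := Cardinal.lift_mk_le'.1 hle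
  refine ⟨fun x c => if hc : c < ω_ (m : Ordinal.{0}) then e x ⟨c, hc⟩ else false,
    fun x x' hx => e.injective (funext fun c => ?_)⟩
  have hc : (c : Ordinal.{0}) < ω_ (m : Ordinal.{0}) := c.2
  simpa [hc] using hx c hc

section Coding

variable {G : Type u} [AddCommGroup G]

open InvSystem

/-- A binary sequence of length `ω_{m+1}` together with a cochain on a chain of that length can be
coded by one binary sequence. -/
theorem exists_code_cochain {m : ℕ} (hG : Cardinal.mk G ≤ 2 ^ ℵ_ (m : Ordinal.{u})) (k : ℕ)
    (s : Ordinal.{0} → EvDom) :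
    ∃ (code : (Ordinal.{0} → Bool) × (QSystem G).Cochain k → Ordinal.{0} → Bool)
      (f : Ordinal.{0} → Ordinal.{0}),
      (∀ a < ω_ ((m + 1 : ℕ) : Ordinal.{0}), f a < ω_ ((m + 1 : ℕ) : Ordinal.{0})) ∧
      ∀ l < ω_ ((m + 1 : ℕ) : Ordinal.{0}), (∀ a < l, f a < l) → ∀ x x',
        (∀ c < l, code x c = code x' c) → (∀ c < l, x.1 c = x'.1 c) ∧
          (QSystem G).AgreeOn (s '' Set.Iio l) x.2 x'.2 := by
  classical
  obtain ⟨gbit, hgbit⟩ := exists_bits hG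
  -- One representative is fixed per class, so a class is determined by the values of its
  -- representative, each coded by `ω_m` bits.
  choose rep hrep using fun f => exists_gridClass_eq (G := G) f
  let bit : (Ordinal.{0} → Bool) × (QSystem G).Cochain k →
      Ordinal.{0} ⊕ ((Fin (k + 1) → Ordinal.{0}) × ℕ × ℕ × Ordinal.{0}) → Bool := fun x =>
    Sum.elim x.1 fun q => if h : Monotone (s ∘ q.1) then
      gbit (rep (s (q.1 0)) (x.2 ⟨s ∘ q.1, h⟩) q.2.1 q.2.2.1) q.2.2.2 else false
  -- Block `a` asks for all bits whose chain indices are at most `a`.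
  let A : Ordinal.{0} → Set (Ordinal.{0} ⊕ ((Fin (k + 1) → Ordinal.{0}) × ℕ × ℕ × Ordinal.{0})) :=
    fun a => Set.range (Sum.map (fun c : Set.Iio (Order.succ a) => (c : Ordinal.{0}))
      fun q : (Fin (k + 1) → Set.Iio (Order.succ a)) × ℕ × ℕ × Set.Iio (ω_ (m : Ordinal.{0})) =>
        ((fun i => (q.1 i : Ordinal.{0})), q.2.1, q.2.2.1, (q.2.2.2 : Ordinal.{0})))
  have hlim := Cardinal.isSuccLimit_omega ((m + 1 : ℕ) : Ordinal.{0})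
  obtain ⟨code, f, hf, hcode⟩ := exists_code (m := m) bit A (fun a ha => by
    refine Cardinal.mk_range_le.trans ?_
    have h1 := mk_Iio_le (hlim.succ_lt ha)
    have h2 : Cardinal.mk (Set.Iio (ω_ (m : Ordinal.{0}))) ≤ ℵ_ (m : Ordinal.{1}) := by simp
    exact mk_sum_le h1 (mk_prod_le (mk_fin_arrow_le h1)
      (mk_prod_le (mk_nat_le m) (mk_prod_le (mk_nat_le m) h2))))
  refine ⟨code, f, hf, fun l hl hcl x x' hxx => ⟨fun c hc => ?_, fun t ht => ?_⟩⟩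
  · exact hcode l hl hcl x x' hxx c hc (Sum.inl c) ⟨Sum.inl ⟨c, Order.lt_succ c⟩, rfl⟩
  · choose q hq hqt using ht
    have hmono : Monotone (s ∘ q) := by
      rw [show s ∘ q = t from funext hqt]
      exact t.monotone
    obtain rfl : t = ⟨s ∘ q, hmono⟩ := OrderHom.ext _ _ (funext fun i => (hqt i).symm)
    let a := Finset.univ.sup' Finset.univ_nonempty q
    have ha : a < l := by simpa [a] using hq
    have hqa : ∀ i, q i < Order.succ a := fun i =>
      Order.lt_succ_of_le (Finset.le_sup' q (Finset.mem_univ i))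
    have hrepeq : rep (s (q 0)) (x.2 ⟨s ∘ q, hmono⟩) = rep (s (q 0)) (x'.2 ⟨s ∘ q, hmono⟩) := by
      funext i j
      refine hgbit _ _ fun c hc => ?_
      have := hcode l hl hcl x x' hxx a ha (Sum.inr (q, i, j, c))
        ⟨Sum.inr (fun i => ⟨q i, hqa i⟩, i, j, ⟨c, hc⟩), rfl⟩
      simpa [bit, hmono] using this
    exact (hrep (s (q 0)) (x.2 ⟨s ∘ q, hmono⟩)).symm.trans
      ((congrArg (fun psi => gridClass G psi (s (q 0))) hrepeq).trans
        (hrep (s (q 0)) (x'.2 ⟨s ∘ q, hmono⟩)))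

end Coding

open InvSystem

/-! ### Filtrations of a join-closed set -/

section Filtration

theorem exists_finset_image_val {X : Type w} [DecidableEq X] {A : Set X} {F : Finset X}
    (h : (F : Set X) ⊆ A) : ∃ F' : Finset A, F'.image Subtype.val = F := by
  have h' : (F : Set X) ⊆ Subtype.val '' (Set.univ : Set A) := by simpa using h
  obtain ⟨F', -, hF'⟩ := Finset.subset_set_image_iff.1 h'
  exact ⟨F', hF'⟩

variable {P : Set EvDom} {m : ℕ} {s p : Ordinal.{0} → EvDom}

/-- A join-closed set of cofinality `ℵ_m` has a cofinal enumeration of length `ω_m` that dominates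
a given one. -/
theorem exists_cofinal_enumeration (hP : ∀ f ∈ P, ∀ g ∈ P, vee f g ∈ P)
    (hcof : Order.cof P = ℵ_ (m : Ordinal.{0})) (hs : ∀ a < ω_ (m : Ordinal.{0}), s a ∈ P) :
    ∃ p : Ordinal.{0} → EvDom, (∀ a < ω_ (m : Ordinal.{0}), p a ∈ P ∧ s a ≤ p a) ∧
      gen P (p '' Set.Iio (ω_ (m : Ordinal.{0}))) = P := by
  obtain ⟨D, hD, hDcard⟩ := Order.exists_cof_eq (α := P)
  have hne : D.Nonempty := by
    rw [← Set.nonempty_coe_sort, ← Cardinal.mk_ne_zero_iff, hDcard, hcof]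
    exact (Cardinal.aleph_pos _).ne'
  obtain ⟨q, hq⟩ := exists_image_Iio_omega hne (hDcard.trans hcof).le
  refine ⟨fun a => vee (s a) (q a), fun a ha => ⟨hP _ (hs a ha) _ (q a).2, left_le_vee _ _⟩,
    (gen_subset _ _).antisymm fun f hf => ?_⟩
  obtain ⟨d, hd, hle⟩ := hD ⟨f, hf⟩
  rw [← hq] at hd
  obtain ⟨a, ha, rfl⟩ := hd
  refine ⟨hf, {vee (s a) (q a)}, Finset.singleton_nonempty _, ?_, ?_⟩
  · rw [Finset.coe_singleton, Set.singleton_subset_iff]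
    exact ⟨a, ha, rfl⟩
  · have hle' : f ≤ ((q a : P) : EvDom) := hle
    exact (hle'.trans (right_le_vee (s a) (q a))).trans (le_bigVee (Finset.mem_singleton_self _))

theorem chain_mem_gen {o : Ordinal.{0}} (hp : ∀ a < o, p a ∈ P ∧ s a ≤ p a)
    (hs : ∀ a < o, s a ∈ P) {a l : Ordinal.{0}} (hal : a < l) (hlo : l ≤ o) :
    s a ∈ gen P (p '' Set.Iio l) := by
  refine ⟨hs a (hal.trans_le hlo), {p a}, by simp, ?_, ?_⟩
  · rw [Finset.coe_singleton, Set.singleton_subset_iff]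
    exact ⟨a, hal, rfl⟩
  · exact (hp a (hal.trans_le hlo)).2.trans (le_bigVee (by simp))

/-- An unbounded chain reflects to an unbounded chain on a club. -/
theorem exists_unboundedIn_closed (hP : ∀ f ∈ P, ∀ g ∈ P, vee f g ∈ P)
    (hp : ∀ a < ω_ ((m + 1 : ℕ) : Ordinal.{0}), p a ∈ P)
    (hunb : UnboundedIn (s '' Set.Iio (ω_ ((m + 1 : ℕ) : Ordinal.{0}))) P) :
    ∃ f : Ordinal.{0} → Ordinal.{0},
      (∀ a < ω_ ((m + 1 : ℕ) : Ordinal.{0}), f a < ω_ ((m + 1 : ℕ) : Ordinal.{0})) ∧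
      ∀ l < ω_ ((m + 1 : ℕ) : Ordinal.{0}), (∀ a < l, f a < l) →
        UnboundedIn (s '' Set.Iio l) (gen P (p '' Set.Iio l)) := by
  classical
  have hlim := Cardinal.isSuccLimit_omega ((m + 1 : ℕ) : Ordinal.{0})
  have hb : ∀ a, ∃ b, a < ω_ ((m + 1 : ℕ) : Ordinal.{0}) → b < ω_ ((m + 1 : ℕ) : Ordinal.{0}) ∧
      ∀ F : Finset EvDom, F.Nonempty → (F : Set EvDom) ⊆ p '' Set.Iio (Order.succ a) →
        ∃ c < b, ¬ s c ≤ bigVee F := by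
    intro a
    by_cases ha : a < ω_ ((m + 1 : ℕ) : Ordinal.{0})
    swap
    · exact ⟨0, fun h => (ha h).elim⟩
    -- No finite join bounds the chain, since it lies in `P`. There are at most `ℵ_m` such joins at
    -- this stage, so the witnesses are bounded below `ω_{m+1}`.
    have hc : ∀ F : Finset (p '' Set.Iio (Order.succ a)), ∃ c < ω_ ((m + 1 : ℕ) : Ordinal.{0}),
        F.Nonempty → ¬ s c ≤ bigVee (F.image Subtype.val) := by
      intro F
      by_cases hF : F.Nonempty
      · have hmem : bigVee (F.image Subtype.val) ∈ P := by
          refine bigVee_mem hP (hF.image _) fun f hf => ?_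
          rw [Finset.coe_image] at hf
          obtain ⟨⟨_, b, hb, rfl⟩, -, rfl⟩ := hf
          exact hp b (lt_trans hb (hlim.succ_lt ha))
        by_contra! hcon
        refine hunb ⟨_, hmem, ?_⟩
        rintro _ ⟨c, hc, rfl⟩
        exact (hcon c hc).2
      · exact ⟨0, Ordinal.omega_pos _, fun h => (hF h).elim⟩
    choose c hc hc' using hc
    obtain ⟨b, hb, hcb⟩ := exists_bound_omega
      (mk_finset_le (mk_image_Iio_le p (hlim.succ_lt ha))) c hc
    refine ⟨b, fun _ => ⟨hb, fun F hF hFA => ?_⟩⟩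
    obtain ⟨F, rfl⟩ := exists_finset_image_val hFA
    exact ⟨c F, hcb F, hc' F (Finset.image_nonempty.1 hF)⟩
  choose f hf using hb
  refine ⟨f, fun a ha => (hf a ha).1, fun l hl hcl => ?_⟩
  rintro ⟨q, hq, hbound⟩
  obtain ⟨b, hbl, -, F, hF, hFA, hle⟩ := mem_gen_image_Iio hq
  obtain ⟨c, hc, hcF⟩ := (hf b (hbl.trans hl)).2 F hF
    (hFA.trans (Set.image_mono fun x hx => Order.lt_succ_of_le (Set.mem_Iic.1 hx)))
  exact hcF ((hbound _ ⟨c, hc.trans (hcl b hbl), rfl⟩).trans hle)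

/-- Finite joins give the upper bound. For the lower bound, each member of a smaller set fails to
dominate some `s c` with `c < l`; the supremum of these `c` is below `l`, and no member dominates
`s` there. -/
theorem cof_gen (hP : ∀ f ∈ P, ∀ g ∈ P, vee f g ∈ P) {o l : Ordinal.{0}} (hl : l ≤ o)
    (hp : ∀ a < o, p a ∈ P ∧ s a ≤ p a) (hs : ∀ a < o, s a ∈ P)
    (hmono : MonotoneOn s (Set.Iio o)) (hcof : l.cof = ℵ_ (m : Ordinal.{0}))
    (hcard : Cardinal.mk (p '' Set.Iio l) ≤ ℵ_ (m : Ordinal.{0}))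
    (hunb : UnboundedIn (s '' Set.Iio l) (gen P (p '' Set.Iio l))) :
    Order.cof (gen P (p '' Set.Iio l)) = ℵ_ (m : Ordinal.{0}) := by
  classical
  have hpP : p '' Set.Iio l ⊆ P := by
    rintro _ ⟨a, ha, rfl⟩
    exact (hp a (lt_of_lt_of_le ha hl)).1
  apply le_antisymm
  · let D : Set (gen P (p '' Set.Iio l)) := {f | ∃ F : Finset (p '' Set.Iio l),
      (f : EvDom) = bigVee (F.image Subtype.val)}
    have hD : IsCofinal D := by
      rintro ⟨f, hfP, F, hF, hFA, hle⟩
      refine ⟨⟨bigVee F, bigVee_mem_gen hP hpP hF hFA⟩, ?_, hle⟩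
      obtain ⟨F, rfl⟩ := exists_finset_image_val hFA
      exact ⟨F, rfl⟩
    refine (Order.cof_le hD).trans (le_trans ?_ (mk_finset_le hcard))
    choose F hF using fun f : D => f.2
    exact Cardinal.mk_le_of_injective (f := F) fun f g h =>
      Subtype.ext (Subtype.ext ((hF f).trans (h ▸ (hF g).symm)))
  · refine Order.le_cof_iff.2 fun D hD => ?_
    by_contra! hlt
    have hc : ∀ d : D, ∃ c < l, ¬ s c ≤ d.1.1 := by
      intro d
      by_contra! hcon
      refine hunb ⟨d.1.1, d.1.2, ?_⟩
      rintro _ ⟨c, hc, rfl⟩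
      exact hcon c hc
    choose c hc hcd using hc
    have hlub : ⨆ d, c d < l := Ordinal.iSup_lt_of_lt_cof (by rwa [hcof]) hc
    obtain ⟨d, hd, hle⟩ := hD ⟨s (⨆ d, c d), chain_mem_gen hp hs hlub hl⟩
    have hcle : c ⟨d, hd⟩ ≤ ⨆ d, c d := Ordinal.le_iSup c _
    exact hcd ⟨d, hd⟩ (le_trans (hmono ((hc _).trans_le hl) (hlub.trans_le hl) hcle) hle)

variable {G : Type u} [AddCommGroup G]

/-- The principle `R(m, G)` at a stage of cofinality `ω_m` of a filtration. -/
theorem R.exists_cochain {k : ℕ} (hR : R (k + 1) G) (hP : ∀ f ∈ P, ∀ g ∈ P, vee f g ∈ P)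
    {o l : Ordinal.{0}} (hl : l ≤ o) (hp : ∀ a < o, p a ∈ P ∧ s a ≤ p a) (hs : ∀ a < o, s a ∈ P)
    (hmono : MonotoneOn s (Set.Iio o)) (hinj : Set.InjOn s (Set.Iio o))
    (hcof : l.cof = ℵ_ ((k + 1 : ℕ) : Ordinal.{0}))
    (hcard : Cardinal.mk (p '' Set.Iio l) ≤ ℵ_ ((k + 1 : ℕ) : Ordinal.{0}))
    (hunb : UnboundedIn (s '' Set.Iio l) (gen P (p '' Set.Iio l))) :
    ∃ x : (QSystem G).Cochain k,
      (QSystem G).AgreeOn (gen P (p '' Set.Iio l)) ((QSystem G).coboundary x) 0 ∧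
      ¬ TrivialOn G (s '' Set.Iio l) x := by
  classical
  -- `R` needs a chain of length exactly `ω_{k+1}`, so `s` is thinned to a cofinal sequence in `l`,
  -- which remains unbounded.
  obtain ⟨g, hg⟩ := Ordinal.exists_isFundamentalSeq (o := l)
    (a := ω_ ((k + 1 : ℕ) : Ordinal.{0})) (by rw [hcof, Cardinal.ord_aleph])
  let g' : Ordinal.{0} → Ordinal.{0} := fun i =>
    if h : i < ω_ ((k + 1 : ℕ) : Ordinal.{0}) then g ⟨i, h⟩ else 0
  have hg' : ∀ i (h : i < ω_ ((k + 1 : ℕ) : Ordinal.{0})), g' i = g ⟨i, h⟩ := fun i h => dif_pos h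
  have hgl : ∀ i < ω_ ((k + 1 : ℕ) : Ordinal.{0}), g' i < l := fun i h => by
    rw [hg' i h]
    exact (g ⟨i, h⟩).2
  have hgmono : StrictMonoOn g' (Set.Iio (ω_ ((k + 1 : ℕ) : Ordinal.{0}))) := by
    intro i hi j hj hij
    rw [hg' i hi, hg' j hj]
    exact hg.strictMono (show (⟨i, hi⟩ : Set.Iio _) < ⟨j, hj⟩ from hij)
  let C := (s ∘ g') '' Set.Iio (ω_ ((k + 1 : ℕ) : Ordinal.{0}))
  have hCs : C ⊆ s '' Set.Iio l := by
    rintro _ ⟨i, hi, rfl⟩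
    exact ⟨g' i, hgl i hi, rfl⟩
  have hCP : C ⊆ gen P (p '' Set.Iio l) := by
    refine hCs.trans ?_
    rintro _ ⟨a, ha, rfl⟩
    exact chain_mem_gen hp hs ha hl
  obtain ⟨x, hx, hxC⟩ := hR (gen P (p '' Set.Iio l)) C hCP (gen_vee hP)
    (cof_gen hP hl hp hs hmono hcof hcard hunb)
    ⟨s ∘ g', ⟨Set.mapsTo_image _ _, fun i hi j hj hij => hgmono.injOn hi hj
      (hinj ((hgl i hi).trans_le hl) ((hgl j hj).trans_le hl) hij), Set.surjOn_image _ _⟩,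
      fun i hi j hj hij => hmono ((hgl i hi).trans_le hl) ((hgl j hj).trans_le hl)
        (hgmono.monotoneOn hi hj hij)⟩
    (by
      rintro ⟨q, hq, hbound⟩
      refine hunb ⟨q, hq, ?_⟩
      rintro _ ⟨a, ha, rfl⟩
      obtain ⟨_, ⟨⟨i, hi⟩, rfl⟩, hai⟩ := hg.isCofinal_range ⟨a, ha⟩
      refine (hmono (lt_of_lt_of_le ha hl) ((hgl i hi).trans_le hl) ?_).trans
        (hbound _ ⟨i, hi, rfl⟩)
      rw [hg' i hi]
      exact hai)
  obtain ⟨x, rfl⟩ := exists_res_eq _ x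
  refine ⟨x, res_eq_iff.1 hx, fun h => hxC ?_⟩
  rw [restrictCochain_res]
  exact trivialFamily_res_iff.2 (h.mono hCs)

end Filtration

/-! ### The stepping-up argument. -/

section Main

variable {G : Type u} [AddCommGroup G] {k : ℕ}

/-- The extension operators that add the coboundary of `W a y + X a` or of `W a y`, according to
the value of `b` at `a`. -/
def branchExt (W : Ordinal.{0} → (QSystem G).Cochain (k + 1) → (QSystem G).Cochain k)
    (X : Ordinal.{0} → (QSystem G).Cochain k) (b : Ordinal.{0} → Bool) (a : Ordinal.{0})
    (y : (QSystem G).Cochain (k + 1)) : (QSystem G).Cochain (k + 1) :=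
  (QSystem G).coboundary (W a y + if b a then X a else 0)

/-- On `S` this coboundary is `y` for either value of `b a`; being a coboundary on all tuples, it is
a cocycle beyond `S` as well. -/
theorem branchExt_spec {W : Ordinal.{0} → (QSystem G).Cochain (k + 1) → (QSystem G).Cochain k}
    {X : Ordinal.{0} → (QSystem G).Cochain k} {b : Ordinal.{0} → Bool} {a : Ordinal.{0}}
    {y : (QSystem G).Cochain (k + 1)} {S : Set EvDom}
    (hW : (QSystem G).AgreeOn S ((QSystem G).coboundary (W a y)) y)
    (hX : (QSystem G).AgreeOn S ((QSystem G).coboundary (X a)) 0) :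
    (QSystem G).AgreeOn S (branchExt W X b a y) y ∧
      (QSystem G).coboundary (branchExt W X b a y) = 0 := by
  refine ⟨fun t ht => ?_, coboundary_coboundary _⟩
  rw [branchExt, coboundary_add, Pi.add_apply, hW t ht]
  cases b a with
  | true =>
    rw [if_pos rfl, hX t ht]
    exact add_zero _
  | false =>
    have : (QSystem G).coboundary (0 : (QSystem G).Cochain k) = 0 := by
      rw [← sub_self (0 : (QSystem G).Cochain k), coboundary_sub, sub_self]
    rw [if_neg Bool.false_ne_true, this]
    exact add_zero _

/-- Stepping up: `R(n, G)` and the weak diamond on `S^n_{n+1}` imply `R(n + 1, G)`. -/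
theorem R.succ_of_weakDiamond (hG : Cardinal.mk G ≤ 2 ^ ℵ_ ((k + 1 : ℕ) : Ordinal.{u}))
    (hR : R (k + 1) G)
    (hD : WeakDiamond (ω_ ((k + 1 + 1 : ℕ) : Ordinal.{0})) (cofSet (k + 1))) :
    R (k + 1 + 1) G := by
  classical
  rintro P C hCP hP hcof ⟨s, hsbij, hsmono⟩ hunb
  obtain rfl := hsbij.image_eq
  set o := ω_ ((k + 1 + 1 : ℕ) : Ordinal.{0})
  have hlim : Order.IsSuccLimit o := Cardinal.isSuccLimit_omega _
  have hs : ∀ a < o, s a ∈ P := fun a ha => hCP ⟨a, ha, rfl⟩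
  obtain ⟨p, hp, hgen⟩ := exists_cofinal_enumeration hP hcof hs
  have hcard : ∀ a < o, Cardinal.mk (p '' Set.Iio a) ≤ ℵ_ ((k + 1 : ℕ) : Ordinal.{0}) :=
    fun a ha => mk_image_Iio_le p ha
  obtain ⟨f₁, hf₁, hunb'⟩ := exists_unboundedIn_closed hP (fun a ha => (hp a ha).1) hunb
  obtain ⟨code, f₂, hf₂, hcode⟩ := exists_code_cochain hG k s
  -- nontrivial cocycles at the stages of cofinality `ω_n`
  have hX : ∀ l, ∃ x : (QSystem G).Cochain k, l < o →
      (QSystem G).AgreeOn (gen P (p '' Set.Iio l)) ((QSystem G).coboundary x) 0 ∧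
      (l.cof = ℵ_ ((k + 1 : ℕ) : Ordinal.{0}) →
        UnboundedIn (s '' Set.Iio l) (gen P (p '' Set.Iio l)) →
        ¬ TrivialOn G (s '' Set.Iio l) x) := by
    intro l
    by_cases hl : l < o ∧ l.cof = ℵ_ ((k + 1 : ℕ) : Ordinal.{0}) ∧
        UnboundedIn (s '' Set.Iio l) (gen P (p '' Set.Iio l))
    · obtain ⟨x, hx, hx'⟩ := hR.exists_cochain hP hl.1.le hp hs hsmono hsbij.injOn hl.2.1
        (hcard l hl.1) hl.2.2
      exact ⟨x, fun _ => ⟨hx, fun _ _ => hx'⟩⟩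
    · refine ⟨0, fun hlo => ⟨fun t ht => ?_, fun h h' => (hl ⟨hlo, h, h'⟩).elim⟩⟩
      rw [← sub_self (0 : (QSystem G).Cochain k), coboundary_sub, sub_self]
  choose X hX using hX
  -- trivializations at all stages
  have hW : ∀ l, ∀ y : (QSystem G).Cochain (k + 1), ∃ w : (QSystem G).Cochain k, l < o →
      (QSystem G).AgreeOn (gen P (p '' Set.Iio l)) ((QSystem G).coboundary y) 0 →
      (QSystem G).AgreeOn (gen P (p '' Set.Iio l)) ((QSystem G).coboundary w) y := by
    intro l y
    by_cases h : l < o ∧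
        (QSystem G).AgreeOn (gen P (p '' Set.Iio l)) ((QSystem G).coboundary y) 0
    · obtain ⟨w, hw⟩ := trivialOn_succ_iff.1 (vanishes_gen hP (k + 1) (k + 1) le_rfl
        (p '' Set.Iio l) (by
          rintro _ ⟨a, ha, rfl⟩
          exact (hp a (lt_trans ha h.1)).1) (hcard l h.1) y h.2)
      exact ⟨w, fun _ _ => hw⟩
    · exact ⟨0, fun h1 h2 => (h ⟨h1, h2⟩).elim⟩
  choose W hW using hW
  have hE : ∀ (b : Ordinal.{0} → Bool), ∀ a < o, ∀ y : (QSystem G).Cochain (k + 1),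
      (QSystem G).AgreeOn {f | f ∈ P ∧ genRank p f < a} ((QSystem G).coboundary y) 0 →
      (QSystem G).AgreeOn {f | f ∈ P ∧ genRank p f < a} (branchExt W X b a y) y ∧
      (QSystem G).AgreeOn {f | f ∈ P ∧ genRank p f ≤ a}
        ((QSystem G).coboundary (branchExt W X b a y)) 0 := by
    intro b a ha y hy
    have hlt := gen_genRank_lt P p ha.le
    rw [hgen] at hlt
    rw [hlt] at hy ⊢
    obtain ⟨h1, h2⟩ := branchExt_spec (b := b) (hW a y ha hy) (hX a ha).1
    exact ⟨h1, fun t _ => congrFun h2 t⟩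
  let Y : (Ordinal.{0} → Bool) → (QSystem G).Cochain (k + 1) := fun b =>
    limitStage (genRank p) (branchExt W X b)
  -- The cochain whose coboundary defines the extension at `a` when the branch takes the value `i`
  -- there. The two choices differ by `X a`.
  let V : Bool → (Ordinal.{0} → Bool) → Ordinal.{0} → (QSystem G).Cochain k := fun i b a =>
    W a (stage (genRank p) (branchExt W X b) a) + if i then X a else 0
  have hV : ∀ i b b' a, (∀ c < a, b c = b' c) → V i b a = V i b' a := by
    intro i b b' a h
    have : stage (genRank p) (branchExt W X b) a = stage (genRank p) (branchExt W X b') a :=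
      stage_congr fun c hc => funext fun y => by rw [branchExt, branchExt, h c hc]
    simp only [V, this]
  have hY : ∀ b, (QSystem G).AgreeOn P ((QSystem G).coboundary (Y b)) 0 := by
    intro b
    have h := coboundary_limitStage_agreeOn (hE b) le_rfl
    have hlt := gen_genRank_lt P p (le_refl o)
    rw [hgen] at hlt
    rwa [hlt] at h
  -- On the chain up to and including `s a`, both `z` and `V (b a) b a` have coboundary `Y b`; their
  -- difference is trivial because `s a` is a largest element.
  have hkey : ∀ b (z : (QSystem G).Cochain k),
      (QSystem G).AgreeOn (s '' Set.Iio o) ((QSystem G).coboundary z) (Y b) →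
      ∀ a < o, TrivialOn G (s '' Set.Iio a) (z - V (b a) b a) := by
    intro b z hz a ha
    have hstage := (hE b a ha _ (coboundary_stage_agreeOn (hE b) ha.le)).1
    have hagree := limitStage_agreeOn hstage
    have hle := gen_genRank_le P p ha
    rw [hgen] at hle
    rw [hle] at hagree
    have hsub : s '' Set.Iio (Order.succ a) ⊆ gen P (p '' Set.Iio (Order.succ a)) := by
      rintro _ ⟨c, hc, rfl⟩
      exact chain_mem_gen hp hs hc (hlim.succ_lt ha).le
    have hsub' : s '' Set.Iio (Order.succ a) ⊆ s '' Set.Iio o :=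
      Set.image_mono fun c hc => lt_trans hc (hlim.succ_lt ha)
    refine (trivialOn_of_top (S := s '' Set.Iio (Order.succ a)) (p := s a)
      ⟨a, Order.lt_succ a, rfl⟩ ?_ ?_).mono
      (Set.image_mono fun c hc => lt_trans hc (Order.lt_succ a))
    · rintro _ ⟨c, hc, rfl⟩
      exact hsmono (lt_trans hc (hlim.succ_lt ha)) ha (Order.lt_succ_iff.1 hc)
    · intro t ht
      rw [coboundary_sub, Pi.sub_apply, hz t fun i => hsub' (ht i)]
      exact sub_eq_zero.2 (hagree t fun i => hsub (ht i))
  -- The colour says whether some pair coded by `c` below `a` has `z` compatible with the value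
  -- `true` at `a`. At closed `a` the choice of pair does not matter.
  obtain ⟨g, hg⟩ := hD fun a c => decide (∃ b z, (∀ e : Set.Iio a, code (b, z) e.1.1 = c e) ∧
    TrivialOn G (s '' Set.Iio a.1) (z - V true b a))
  -- The branch takes the value opposite to the guess.
  let b : Ordinal.{0} → Bool := fun a => if h : a < o then !g ⟨a, h⟩ else false
  refine ⟨(QSystem G).res P (Y b), res_eq_iff.2 (hY b), fun htriv => ?_⟩
  rw [restrictCochain_res] at htriv
  obtain ⟨z, hz⟩ := trivialOn_succ_iff.1 (trivialFamily_res_iff.1 htriv)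
  obtain ⟨⟨a, ha⟩, ⟨haS, hga⟩, hcl⟩ := hg (fun c => code (b, z) c.1)
    (isClub_closed (f := fun c => max (f₁ c) (f₂ c)) fun c hc => max_lt (hf₁ c hc) (hf₂ c hc))
  have ha' : a < o := ha
  have hcl₁ : ∀ c < a, f₁ c < a := fun c hc => (le_max_left _ _).trans_lt (hcl c hc)
  have hcl₂ : ∀ c < a, f₂ c < a := fun c hc => (le_max_right _ _).trans_lt (hcl c hc)
  have hba : b a = !g ⟨a, ha⟩ := dif_pos ha'
  have htr := hkey b z hz a ha'
  -- If the guess is `true`, `z` is compatible with both values, so their difference `X a` is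
  -- trivial on `s '' Set.Iio a`. If it is `false`, then `b a` is `true` and the pair `(b, z)`
  -- itself refutes the colour.
  cases hgv : g ⟨a, ha⟩ with
  | true =>
    rw [hba, hgv] at htr
    rw [hgv, eq_comm, decide_eq_true_iff] at hga
    obtain ⟨b', z', hcd, htr'⟩ := hga
    obtain ⟨hb, hzz⟩ := hcode a ha' hcl₂ (b', z') (b, z) fun c hc =>
      hcd ⟨⟨c, lt_trans hc ha'⟩, hc⟩
    rw [hV true b' b a hb] at htr'
    refine (hX a ha').2 haS (hunb' a ha' hcl₁) ((htr.sub htr').congr fun t ht => ?_)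
    have hzt : z' t = z t := hzz t ht
    simp [V, hzt]
  | false =>
    rw [hba, hgv] at htr
    rw [hgv, eq_comm, decide_eq_false_iff_not] at hga
    exact hga ⟨b, z, fun _ => rfl, htr⟩

end Main

end DerivedLim

end

theorem mainTheorem5 (n : ℕ) (hn : 1 ≤ n) (G : Type*) [AddCommGroup G]
    (hG : Cardinal.mk G ≤ 2 ^ Cardinal.aleph (n : Ordinal))
    (hR : DerivedLim.R n G)
    (hD : DerivedLim.WeakDiamond (Ordinal.omega ((n + 1 : ℕ) : Ordinal.{0}))
      (DerivedLim.cofSet n)) :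
    DerivedLim.R (n + 1) G := by
  obtain ⟨k, rfl⟩ : ∃ k, n = k + 1 := ⟨n - 1, by omega⟩
  exact hR.succ_of_weakDiamond hG hD
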